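/- All graphs are finite and simple; $\chi(G)$ and $\omega(G)$ denote the chromatic number and the clique number of $G$. Let $P_2\cup P_4$ be the disjoint union of a path on two vertices and a path on four vertices, and let HVN be the graph obtained from $K_5$ by removing two edges incident to the same vertex. A graph is $(P_2\cup P_4,\mathrm{HVN})$-free if it has no induced subgraph isomorphic to $P_2\cup P_4$ or to HVN. **Theorem 1.1.** Let $G$ be a $(P_2\cup P_4,\mathrm{HVN})$-free graph. Then $$\chi(G)\le\begin{cases}4 & \text{if }\omega(G)=2,\\ 10 & \text{if }\omega(G)=3,\\ \lceil\tfrac43\,\omega(G)\rceil & \text{if }\omega(G)\ge4.\end{cases}$$ Moreover, the bounds for $\omega=2$ and for every $\omega\ge4$ are tight: 1. The Mycielski–Grötzsch graph (the Mycielskian of the $5$-cycle, on $11$ vertices) is $(P_2\cup P_4,\mathrm{HVN})$-free, has clique number $2$ and has chromatic number $4$. 2. For every integer $n\ge4$, let $G_n$ be the graph on $2n^2$ vertices $a_i^s,b_i^s$ ($1\le i,s\le n$) in which $a_i^s\sim a_j^t$ if and only if $i\ne j$, $b_i^s\sim b_j^t$ if and only if $i\ne j$, and $a_j^s\sim b_i^t$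 if and only if $s=i$ and $t=j$. (So $G_n$ consists of two complete $n$-partite graphs with parts of size $n$, joined by a perfect matching that joins each part of the first to each part of the second by exactly one edge.) Then $G_n$ is $(P_2\cup P_4,\mathrm{HVN})$-free, $\omega(G_n)=n$ and $\chi(G_n)=\lceil\tfrac43 n\rceil$. -/

import Mathlib

/-- The disjoint union `P₂ ∪ P₄` of a path on two vertices and a path on four vertices. -/
def graphP2P4 : SimpleGraph (Fin 2 ⊕ Fin 4) :=
  SimpleGraph.pathGraph 2 ⊕g SimpleGraph.pathGraph 4

/-- The HVN: the complete graph on five vertices with two edges at the vertex `0` removed. -/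
def graphHVN : SimpleGraph (Fin 5) :=
  (⊤ : SimpleGraph (Fin 5)).deleteEdges {s(0, 1), s(0, 2)}

/-- `G` is `(P₂ ∪ P₄, HVN)`-free: no induced subgraph of `G` is isomorphic to `P₂ ∪ P₄`
or to the HVN. -/
def IsP2P4HVNFree {V : Type*} (G : SimpleGraph V) : Prop :=
  ¬ graphP2P4.IsIndContained G ∧ ¬ graphHVN.IsIndContained G

/-- Adjacency in the Mycielskian of `G`: the vertices are those of `G` (`some (inl v)`),
a copy `some (inr v)` of each of them, and an apex `none`. A copy `v'` is adjacent to the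
neighbours of `v` in `G`, and the apex is adjacent to all copies. -/
def MycielskiAdj {V : Type*} (G : SimpleGraph V) : Option (V ⊕ V) → Option (V ⊕ V) → Prop
  | some (Sum.inl u), some (Sum.inl v) => G.Adj u v
  | some (Sum.inl u), some (Sum.inr v) => G.Adj u v
  | some (Sum.inr u), some (Sum.inl v) => G.Adj u v
  | some (Sum.inr _), none => True
  | none, some (Sum.inr _) => True
  | _, _ => False

/-- The Mycielskian of a graph. -/
def mycielskian {V : Type*} (G : SimpleGraph V) : SimpleGraph (Option (V ⊕ V)) where
  Adj := MycielskiAdj G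
  symm := ⟨by
    rintro (_ | u | u) (_ | v | v) h <;> first | exact h | exact G.adj_symm h⟩
  loopless := ⟨by
    rintro (_ | u | u) h <;> first | exact h | exact G.loopless.irrefl u h⟩

/-- The Mycielski–Grötzsch graph (on 11 vertices): the Mycielskian of the 5-cycle. -/
def grotzschGraph : SimpleGraph (Option (Fin 5 ⊕ Fin 5)) :=
  mycielskian (SimpleGraph.cycleGraph 5)

/-- Adjacency in `twinMultipartite n`. The vertex `inl (i, s)` is the `s`-th vertex of the part
`A_i` and `inr (i, s)` is the `s`-th vertex of the part `B_i`. -/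
def TwinAdj (n : ℕ) : (Fin n × Fin n) ⊕ (Fin n × Fin n) → (Fin n × Fin n) ⊕ (Fin n × Fin n) → Prop
  | Sum.inl p, Sum.inl q => p.1 ≠ q.1
  | Sum.inr p, Sum.inr q => p.1 ≠ q.1
  | Sum.inl p, Sum.inr q => p.1 = q.2 ∧ p.2 = q.1
  | Sum.inr p, Sum.inl q => p.1 = q.2 ∧ p.2 = q.1

/-- Two disjoint complete `n`-partite graphs `A`, `B` with parts `A_i`, `B_i` of size `n`,
joined by the perfect matching in which the `i`-th vertex of `A_j` is matched with the `j`-th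
vertex of `B_i`. -/
def twinMultipartite (n : ℕ) : SimpleGraph ((Fin n × Fin n) ⊕ (Fin n × Fin n)) where
  Adj := TwinAdj n
  symm := ⟨by
    rintro (p | p) (q | q) h
    · exact Ne.symm h
    · exact ⟨h.2.symm, h.1.symm⟩
    · exact ⟨h.2.symm, h.1.symm⟩
    · exact Ne.symm h⟩
  loopless := ⟨by
    rintro (p | p) h <;> exact h rfl⟩

/-! Freeness is used through `NoEdgeAndPath` and `NoHalfJoinedK4`. By the first, the vertices
anticomplete to an edge induce no P₄. A P₄-free graph is perfect, so these vertices need only as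
many colours as their largest clique. For ω = 2 and ω = 3 it is enough to split the vertices by
their adjacency to an edge or a triangle.

Let n = ω ≥ 4. The vertices missing exactly one vertex of a fixed maximum clique form a complete
n-partite graph T, and any other vertex sees at most one part of T, its label
(`isMultipartite_twinPart`, `hitsAtMostOne_twinPart`). If there is no K₄ outside T, then n + 2 ≤
⌈4n/3⌉ colours suffice (`NoEdgeAndPath.colorable_of_cliqueBoundOn_three`). Otherwise the same
construction outside T gives a second complete multipartite graph S with 4 ≤ q ≤ n parts, and each
remaining vertex has at most one label in T and at most one in S.

`TwoMultipartite.colorable` then looks at the edges among the remaining vertices. A parallel edge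
forces a core: apart from one part, S sees at most a single part of T. Then S can reuse the colours
of T, and n + 2 colours suffice (`Core.colorable`). If there are edges but none is parallel, each
has two different labels on both sides; this forces n = 4, and six colours are given explicitly
(`colorable_six`). If there are no edges, either a vertex of T sees two parts of S, which is again a
core, or every vertex of T and S sees at most one part of the other. In the last case parts with one
colour on one side are played against parts with two colours on the other (`colorable_of_stable`).

This trade-off is unavoidable in `twinMultipartite n`: one-coloured parts on opposite sides are
joined by an edge, so they have different colours, and counting colours gives 4n ≤ 3k. For ω = 2 the
lower bound holds because the Mycielskian needs one more colour than the 5-cycle. -/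

/-- No edge `e f` is anticomplete to an induced path `a b c d`. -/
def NoEdgeAndPath {V : Type*} (G : SimpleGraph V) : Prop :=
  ∀ e f a b c d : V, G.Adj e f → G.Adj a b → G.Adj b c → G.Adj c d →
    ¬ G.Adj a c → ¬ G.Adj b d → ¬ G.Adj a d →
    ¬ G.Adj e a → ¬ G.Adj e b → ¬ G.Adj e c → ¬ G.Adj e d →
    ¬ G.Adj f a → ¬ G.Adj f b → ¬ G.Adj f c → ¬ G.Adj f d → False

/-- No vertex is adjacent to exactly the two vertices `a`, `b` of a `K₄` on `a b c d`. -/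
def NoHalfJoinedK4 {V : Type*} (G : SimpleGraph V) : Prop :=
  ∀ x a b c d : V, G.Adj a b → G.Adj a c → G.Adj a d → G.Adj b c → G.Adj b d → G.Adj c d →
    G.Adj x a → G.Adj x b → ¬ G.Adj x c → ¬ G.Adj x d → False

/-! ### Elementary forms of the two forbidden induced subgraphs -/

section Free

variable {V : Type*} {G : SimpleGraph V}

theorem noEdgeAndPath_of_not_isIndContained (h : ¬ graphP2P4.IsIndContained G) :
    NoEdgeAndPath G := by
  intro e f a b c d hef hab hbc hcd hac hbd had hea heb hec hed hfa hfb hfc hfd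
  apply h
  have key : ∀ x y : Fin 2 ⊕ Fin 4,
      G.Adj (Sum.elim ![e, f] ![a, b, c, d] x) (Sum.elim ![e, f] ![a, b, c, d] y) ↔
        graphP2P4.Adj x y := by
    have h1 := hef.symm
    have h2 := hab.symm
    have h3 := hbc.symm
    have h4 := hcd.symm
    rintro (x | x) (y | y) <;> fin_cases x <;> fin_cases y <;>
      simp [graphP2P4, SimpleGraph.pathGraph_adj, *] <;>
      (intro h'; have h'' := h'.symm; contradiction)
  refine ⟨⟨⟨Sum.elim ![e, f] ![a, b, c, d], ?_⟩, @fun x y => key x y⟩⟩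
  -- Distinct vertices of P₂ ∪ P₄ have distinct neighbourhoods, so a map that preserves and reflects
  -- adjacency is injective.
  have hne : ∀ x y : Fin 2 ⊕ Fin 4, x ≠ y → ∃ z, ¬ (graphP2P4.Adj x z ↔ graphP2P4.Adj y z) := by
    let _ (n : ℕ) : DecidableRel (SimpleGraph.pathGraph n).Adj :=
      fun _ _ => decidable_of_iff _ SimpleGraph.pathGraph_adj.symm
    simp only [graphP2P4]
    rintro (x | x) (y | y) hxy <;> fin_cases x <;> fin_cases y <;> simp_all <;> decide
  intro x y hxy
  by_contra hcon
  obtain ⟨z, hz⟩ := hne x y hcon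
  exact hz (by rw [← key, ← key, hxy])

theorem noHalfJoinedK4_of_not_isIndContained (h : ¬ graphHVN.IsIndContained G) :
    NoHalfJoinedK4 G := by
  intro x a b c d hab hac had hbc hbd hcd hxa hxb hxc hxd
  apply h
  have key : ∀ i j : Fin 5, G.Adj (![x, c, d, a, b] i) (![x, c, d, a, b] j) ↔
      graphHVN.Adj i j := by
    have h1 := hab.symm
    have h2 := hac.symm
    have h3 := had.symm
    have h4 := hbc.symm
    have h5 := hbd.symm
    have h6 := hcd.symm
    have h7 := hxa.symm
    have h8 := hxb.symm
    intro i j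
    fin_cases i <;> fin_cases j <;>
      simp [graphHVN, SimpleGraph.deleteEdges_adj, *] <;>
      (intro h'; have h'' := h'.symm; contradiction)
  refine ⟨⟨⟨![x, c, d, a, b], ?_⟩, @fun i j => key i j⟩⟩
  -- Adjacent vertices have distinct images anyway; only the two removed edges need an argument.
  have hxc' : x ≠ c := by rintro rfl; contradiction
  have hxd' : x ≠ d := by rintro rfl; exact hxc hcd.symm
  intro i j hij
  by_contra hcon
  have hadj : ¬ graphHVN.Adj i j := fun hh => (((key i j).2 hh).ne) hij
  fin_cases i <;> fin_cases j <;> simp_all [graphHVN]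
  
end Free

/-! ### Perfection of P₄-free sets; clique numbers 2 and 3 -/

/-- The set `s` contains no induced path on four vertices. -/
def PathFourFreeOn {V : Type*} (G : SimpleGraph V) (s : Set V) : Prop :=
  ∀ a ∈ s, ∀ b ∈ s, ∀ c ∈ s, ∀ d ∈ s, G.Adj a b → G.Adj b c → G.Adj c d →
    ¬ G.Adj a c → ¬ G.Adj b d → ¬ G.Adj a d → False

/-- All cliques inside `s` have at most `k` vertices. -/
def CliqueBoundOn {V : Type*} (G : SimpleGraph V) (s : Set V) (k : ℕ) : Prop :=
  ∀ t : Finset V, ↑t ⊆ s → G.IsClique t → t.card ≤ k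

/-- `f` is a proper colouring of the set `s` with colours from `C`. -/
def ProperOn {V : Type*} (G : SimpleGraph V) (s : Set V) (C : Finset ℕ) (f : V → ℕ) : Prop :=
  (∀ x ∈ s, f x ∈ C) ∧ ∀ x ∈ s, ∀ y ∈ s, G.Adj x y → f x ≠ f y

section Perfect

variable {V : Type*} {G : SimpleGraph V}

theorem PathFourFreeOn.mono {s t : Set V} (h : PathFourFreeOn G t) (hst : s ⊆ t) :
    PathFourFreeOn G s := fun a ha b hb c hc d hd =>
  h a (hst ha) b (hst hb) c (hst hc) d (hst hd)

theorem CliqueBoundOn.mono {s t : Set V} {k l : ℕ} (h : CliqueBoundOn G t k) (hst : s ⊆ t)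
    (hkl : k ≤ l) : CliqueBoundOn G s l :=
  fun u hu hc => (h u (hu.trans hst) hc).trans hkl

/-- In a set without induced `P₄` a maximal stable set meets every maximum clique. -/
theorem PathFourFreeOn.stable_meets_clique [Finite V] {s : Set V} (hs : PathFourFreeOn G s) {k : ℕ}
    (hk : CliqueBoundOn G s k) {I : Set V} (hIs : I ⊆ s) (hI : ∀ x ∈ I, ∀ y ∈ I, ¬ G.Adj x y)
    (hmax : ∀ x ∈ s, x ∉ I → ∃ y ∈ I, G.Adj x y) {t : Finset V} (hts : ↑t ⊆ s)
    (htI : ∀ x ∈ t, x ∉ I) (ht : G.IsClique t) (hne : t.Nonempty) : t.card < k := by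
  classical
  by_contra hcon
  have hIne : I.Nonempty := by
    obtain ⟨x, hx⟩ := hne
    obtain ⟨y, hy, -⟩ := hmax x (hts hx) (htI x hx)
    exact ⟨y, hy⟩
  -- Let `u ∈ I` have the most neighbours in `t`. It misses some `a ∈ t`, as `t` cannot be enlarged.
  -- A neighbour `w ∈ I` of `a` must miss some neighbour `b` of `u`, and `u b a w` is an induced P₄.
  obtain ⟨u, huI, hu⟩ := Set.exists_max_image I (fun u => (t.filter (G.Adj u)).card)
    (Set.toFinite I) hIne
  obtain ⟨a, hat, hua⟩ : ∃ a ∈ t, ¬ G.Adj u a := by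
    by_contra! hall
    have hut : u ∉ t := fun h => htI u h huI
    have := hk (insert u t) (by
      intro x hx
      rcases Finset.mem_insert.1 (Finset.mem_coe.1 hx) with rfl | hx
      · exact hIs huI
      · exact hts hx) (by
      rw [Finset.coe_insert]
      exact ht.insert fun b hb _ => hall b hb)
    rw [Finset.card_insert_of_notMem hut] at this
    omega
  obtain ⟨w, hwI, haw⟩ := hmax a (hts hat) (htI a hat)
  obtain ⟨b, hbt, hub, hwb⟩ : ∃ b ∈ t, G.Adj u b ∧ ¬ G.Adj w b := by
    by_contra! hall
    have hlt : (t.filter (G.Adj u)).card < (t.filter (G.Adj w)).card := by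
      apply Finset.card_lt_card
      refine Finset.ssubset_iff_of_subset ?_ |>.2 ⟨a, ?_, ?_⟩
      · intro b hb
        rw [Finset.mem_filter] at hb ⊢
        exact ⟨hb.1, hall b hb.1 hb.2⟩
      · exact Finset.mem_filter.2 ⟨hat, haw.symm⟩
      · exact fun h => hua (Finset.mem_filter.1 h).2
    exact absurd (hu w hwI) (not_le.2 hlt)
  have hba : G.Adj b a := ht hbt hat (by rintro rfl; exact hua hub)
  exact hs u (hIs huI) b (hts hbt) a (hts hat) w (hIs hwI) hub hba haw hua
    (fun h => hwb h.symm) (hI u huI w hwI)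

theorem exists_maximal_stable [Finite V] (s : Set V) :
    ∃ I ⊆ s, (∀ x ∈ I, ∀ y ∈ I, ¬ G.Adj x y) ∧ ∀ x ∈ s, x ∉ I → ∃ y ∈ I, G.Adj x y := by
  obtain ⟨I, hI⟩ := (Set.toFinite {I : Set V | I ⊆ s ∧ ∀ x ∈ I, ∀ y ∈ I, ¬ G.Adj x y}).exists_maximal
    ⟨∅, by simp⟩
  refine ⟨I, hI.prop.1, hI.prop.2, fun x hx hxI => ?_⟩
  by_contra! hall
  have hmem : insert x I ∈ {I : Set V | I ⊆ s ∧ ∀ x ∈ I, ∀ y ∈ I, ¬ G.Adj x y} := by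
    refine ⟨Set.insert_subset hx hI.prop.1, ?_⟩
    rintro a (rfl | ha) b (rfl | hb)
    · exact G.irrefl
    · exact hall b hb
    · exact fun h => hall a ha h.symm
    · exact hI.prop.2 a ha b hb
  exact hxI (hI.le_of_ge hmem (Set.subset_insert x I) (Set.mem_insert x I))

/-- A set without induced `P₄` can be coloured with as many colours as its clique number. -/
theorem PathFourFreeOn.exists_properOn [Finite V] {k : ℕ} {s : Set V} {C : Finset ℕ}
    (hs : PathFourFreeOn G s) (hk : CliqueBoundOn G s k) (hC : k ≤ C.card) :
    ∃ f, ProperOn G s C f := by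
  classical
  induction k generalizing s C with
  | zero =>
    have hemp : ∀ x, x ∉ s := fun x hx => by
      have := hk {x} (by simpa using hx) (by simp)
      simp at this
    exact ⟨fun _ => 0, fun x hx => (hemp x hx).elim, fun x hx => (hemp x hx).elim⟩
  | succ k ih =>
    -- Removing a maximal stable set lowers the clique bound by one, so it can be a colour class.
    obtain ⟨I, hIs, hI, hmax⟩ := exists_maximal_stable (G := G) s
    obtain ⟨c, hc⟩ : C.Nonempty := Finset.card_pos.1 (by omega)
    obtain ⟨f, hf1, hf2⟩ := ih (s := s \ I) (C := C.erase c) (hs.mono Set.sdiff_subset)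
      (by
        intro t ht hcl
        rcases t.eq_empty_or_nonempty with rfl | hne
        · simp
        · exact Nat.le_of_lt_succ (hs.stable_meets_clique hk hIs hI hmax
            (ht.trans Set.sdiff_subset) (fun x hx => (ht hx).2) hcl hne))
      (by rw [Finset.card_erase_of_mem hc]; omega)
    refine ⟨fun x => if x ∈ I then c else f x, fun x hx => ?_, fun x hx y hy hxy => ?_⟩
    · by_cases h : x ∈ I
      · simpa [h] using hc
      · simpa [h] using Finset.mem_of_mem_erase (hf1 x ⟨hx, h⟩)
    · by_cases h : x ∈ I <;> by_cases h' : y ∈ I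
      · exact absurd hxy (hI x h y h')
      · simpa [h, h'] using (Finset.ne_of_mem_erase (hf1 y ⟨hy, h'⟩)).symm
      · simpa [h, h'] using Finset.ne_of_mem_erase (hf1 x ⟨hx, h⟩)
      · simpa [h, h'] using hf2 x ⟨hx, h⟩ y ⟨hy, h'⟩ hxy

/-- The source of the nontrivial palettes below: to colour a set economically, find an edge
anticomplete to it. -/
theorem NoEdgeAndPath.pathFourFreeOn (hP : NoEdgeAndPath G) {e f : V} (hef : G.Adj e f) {s : Set V}
    (hs : ∀ x ∈ s, ¬ G.Adj e x ∧ ¬ G.Adj f x) : PathFourFreeOn G s :=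
  fun a ha b hb c hc d hd hab hbc hcd hac hbd had =>
    hP e f a b c d hef hab hbc hcd hac hbd had (hs a ha).1 (hs b hb).1 (hs c hc).1 (hs d hd).1
      (hs a ha).2 (hs b hb).2 (hs c hc).2 (hs d hd).2

theorem colorable_of_properOn_univ {f : V → ℕ} {m : ℕ}
    (h : ProperOn G Set.univ (Finset.range m) f) : G.Colorable m :=
  ⟨SimpleGraph.Coloring.mk (fun x => (⟨f x, Finset.mem_range.1 (h.1 x trivial)⟩ : Fin m))
    fun {x y} hxy heq => h.2 x trivial y trivial hxy (by simpa using heq)⟩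

/-- `s` has a proper colouring with `k` colours. -/
def ColorableOn {V : Type*} (G : SimpleGraph V) (s : Set V) (k : ℕ) : Prop :=
  ∃ f, ProperOn G s (Finset.range k) f

theorem ColorableOn.union {s t : Set V} {k l : ℕ} (hs : ColorableOn G s k)
    (ht : ColorableOn G t l) : ColorableOn G (s ∪ t) (k + l) := by
  classical
  obtain ⟨f, hf1, hf2⟩ := hs
  obtain ⟨g, hg1, hg2⟩ := ht
  simp only [Finset.mem_range] at hf1 hg1
  refine ⟨fun x => if x ∈ s then f x else k + g x, fun x hx => ?_, fun x hx y hy hxy => ?_⟩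
  · rw [Finset.mem_range]
    by_cases h : x ∈ s
    · have := hf1 x h
      simp only [h, if_true]; omega
    · have := hg1 x (hx.resolve_left h)
      simp only [h, if_false]; omega
  · by_cases h : x ∈ s <;> by_cases h' : y ∈ s <;> simp only [h, h', if_true, if_false]
    · exact hf2 x h y h' hxy
    · have := hf1 x h; omega
    · have := hf1 y h'; omega
    · have := hg2 x (hx.resolve_left h) y (hy.resolve_left h') hxy; omega

theorem ColorableOn.colorable {s : Set V} {k : ℕ} (h : ColorableOn G s k) (hs : ∀ x, x ∈ s) :
    G.Colorable k := by
  obtain ⟨f, hf⟩ := h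
  rw [Set.eq_univ_of_forall hs] at hf
  exact colorable_of_properOn_univ hf

theorem colorableOn_of_stable {s : Set V} (hs : ∀ x ∈ s, ∀ y ∈ s, ¬ G.Adj x y) :
    ColorableOn G s 1 :=
  ⟨fun _ => 0, by simp, fun x hx y hy hxy => absurd hxy (hs x hx y hy)⟩

theorem NoEdgeAndPath.colorableOn [Finite V] (hP : NoEdgeAndPath G) {e f : V} (hef : G.Adj e f)
    {s : Set V} (hs : ∀ x ∈ s, ¬ G.Adj e x ∧ ¬ G.Adj f x) {k : ℕ} (hk : CliqueBoundOn G s k) :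
    ColorableOn G s k :=
  (hP.pathFourFreeOn hef hs).exists_properOn hk (by simp)

theorem CliqueBoundOn.nbhd {s : Set V} {k : ℕ} (hk : CliqueBoundOn G Set.univ (k + 1)) {v : V}
    (hs : ∀ x ∈ s, G.Adj v x) : CliqueBoundOn G s k := by
  classical
  intro t ht hcl
  have hvt : v ∉ t := fun h => G.irrefl (hs v (ht h))
  have := hk (insert v t) (Set.subset_univ _) (by
    rw [Finset.coe_insert]
    exact hcl.insert fun b hb _ => hs b (ht hb))
  rw [Finset.card_insert_of_notMem hvt] at this
  omega

theorem CliqueBoundOn.not_adj {s : Set V} (hk : CliqueBoundOn G s 1) :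
    ∀ x ∈ s, ∀ y ∈ s, ¬ G.Adj x y := by
  classical
  intro x hx y hy hxy
  have := hk {x, y} (by simp [Set.insert_subset_iff, hx, hy])
    (by simp [hxy.ne, hxy])
  rw [Finset.card_pair hxy.ne] at this
  omega

/-- The neighbourhoods of `v` and `w` are stable, and the vertices missing both need two colours: 2
+ 1 + 1. -/
theorem NoEdgeAndPath.colorable_four [Finite V] (hP : NoEdgeAndPath G)
    (hk : CliqueBoundOn G Set.univ 2) {v w : V} (hvw : G.Adj v w) : G.Colorable 4 := by
  have h1 : ColorableOn G {x | ¬ G.Adj v x ∧ ¬ G.Adj w x} 2 :=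
    hP.colorableOn hvw (fun x hx => hx) (hk.mono (Set.subset_univ _) le_rfl)
  have h2 : ColorableOn G {x | G.Adj v x} 1 :=
    colorableOn_of_stable (CliqueBoundOn.not_adj (hk.nbhd fun x hx => hx))
  have h3 : ColorableOn G {x | G.Adj w x} 1 :=
    colorableOn_of_stable (CliqueBoundOn.not_adj (hk.nbhd fun x hx => hx))
  refine ((h1.union h2).union h3).colorable fun x => ?_
  simp only [Set.mem_union, Set.mem_ofPred_eq]
  tauto

/-- Vertices missing `u` and `v` need 3 colours. Those seeing only `v`, or only `u`, of the triangle
are anticomplete to the opposite edge and need 2 each. The three common neighbourhoods of two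
triangle vertices are stable: 3 + 2 + 2 + 1 + 1 + 1. -/
theorem NoEdgeAndPath.colorable_ten [Finite V] (hP : NoEdgeAndPath G)
    (hk : CliqueBoundOn G Set.univ 3) {u v w : V} (huv : G.Adj u v) (huw : G.Adj u w)
    (hvw : G.Adj v w) : G.Colorable 10 := by
  have h1 : ColorableOn G {x | ¬ G.Adj u x ∧ ¬ G.Adj v x} 3 :=
    hP.colorableOn huv (fun x hx => hx) (hk.mono (Set.subset_univ _) le_rfl)
  have h2 : ColorableOn G {x | G.Adj v x ∧ ¬ G.Adj u x ∧ ¬ G.Adj w x} 2 :=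
    hP.colorableOn huw (fun x hx => hx.2) (hk.nbhd fun x hx => hx.1)
  have h3 : ColorableOn G {x | G.Adj u x ∧ ¬ G.Adj v x ∧ ¬ G.Adj w x} 2 :=
    hP.colorableOn hvw (fun x hx => hx.2) (hk.nbhd fun x hx => hx.1)
  have h4 : ∀ a b : V, G.Adj a b → ColorableOn G {x | G.Adj a x ∧ G.Adj b x} 1 := by
    intro a b hab
    refine colorableOn_of_stable (CliqueBoundOn.not_adj (V := V) ?_)
    classical
    intro t ht hcl
    have hat : a ∉ t := fun h => G.irrefl (ht h).1
    have hbt : b ∉ t := fun h => G.irrefl (ht h).2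
    have := hk (insert a (insert b t)) (Set.subset_univ _) (by
      rw [Finset.coe_insert, Finset.coe_insert]
      refine (hcl.insert fun c hc _ => (ht hc).2).insert fun c hc _ => ?_
      rcases hc with rfl | hc
      · exact hab
      · exact (ht hc).1)
    rw [Finset.card_insert_of_notMem (by simp [hat, hab.ne]), Finset.card_insert_of_notMem hbt]
      at this
    omega
  refine (((((h1.union h2).union h3).union (h4 u v huv)).union (h4 u w huw)).union
    (h4 v w hvw)).colorable fun x => ?_
  simp only [Set.mem_union, Set.mem_ofPred_eq]
  tauto

end Perfect

/-! ### Complete multipartite graphs grown from maximum cliques -/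

/-- The sets `T i` are the nonempty parts of an induced complete multipartite graph. -/
structure IsMultipartite {V : Type*} (G : SimpleGraph V) {n : ℕ} (T : Fin n → Set V) : Prop where
  nonempty : ∀ i, (T i).Nonempty
  adj_iff : ∀ {i j x y}, x ∈ T i → y ∈ T j → (G.Adj x y ↔ i ≠ j)

open Classical in
/-- The index of a part of `T` in which `x` has a neighbour, if there is one. -/
noncomputable def label {V : Type*} (G : SimpleGraph V) {n : ℕ} (T : Fin n → Set V) (x : V) :
    Option (Fin n) :=
  if h : ∃ i, ∃ t ∈ T i, G.Adj x t then some h.choose else none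

/-- The vertex `x` has neighbours in at most one part of `T`. -/
def HitsAtMostOne {V : Type*} (G : SimpleGraph V) {n : ℕ} (T : Fin n → Set V) (x : V) : Prop :=
  ∀ i j, ∀ s ∈ T i, ∀ t ∈ T j, G.Adj x s → G.Adj x t → i = j

/-- The vertices of `U` whose neighbourhood in the clique `v` misses exactly `v i`. -/
def twinPart {V : Type*} (G : SimpleGraph V) {q : ℕ} (U : Set V) (v : Fin q → V) (i : Fin q) :
    Set V :=
  {x | x ∈ U ∧ ∀ j, G.Adj x (v j) ↔ j ≠ i}

section Multipartite

variable {V : Type*} {G : SimpleGraph V} {n q : ℕ} {T : Fin n → Set V}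

theorem exists_adj_of_label {x : V} {i : Fin n} (h : label G T x = some i) :
    ∃ t ∈ T i, G.Adj x t := by
  unfold label at h
  split_ifs at h with hx
  obtain rfl := Option.some.inj h
  exact hx.choose_spec

/-- `label` chooses an arbitrary part with a neighbour; for these vertices the choice is forced. -/
theorem HitsAtMostOne.label_eq {x t : V} {i : Fin n} (hx : HitsAtMostOne G T x) (ht : t ∈ T i)
    (hxt : G.Adj x t) : label G T x = some i := by
  have hex : ∃ i, ∃ t ∈ T i, G.Adj x t := ⟨i, t, ht, hxt⟩
  obtain ⟨s, hs, hxs⟩ := hex.choose_spec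
  rw [label, dif_pos hex, hx _ _ s hs t ht hxs hxt]

theorem HitsAtMostOne.not_adj {x t : V} {i : Fin n} (hx : HitsAtMostOne G T x) (ht : t ∈ T i)
    (hi : label G T x ≠ some i) : ¬ G.Adj x t :=
  fun hxt => hi (hx.label_eq ht hxt)

theorem IsMultipartite.adj (hT : IsMultipartite G T) {i j : Fin n} {x y : V} (hx : x ∈ T i)
    (hy : y ∈ T j) (hij : i ≠ j) : G.Adj x y := (hT.adj_iff hx hy).2 hij

theorem IsMultipartite.not_adj (hT : IsMultipartite G T) {i : Fin n} {x y : V} (hx : x ∈ T i)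
    (hy : y ∈ T i) : ¬ G.Adj x y := fun h => (hT.adj_iff hx hy).1 h rfl

theorem IsMultipartite.eq_index (hT : IsMultipartite G T) {i j : Fin n} {x : V} (hx : x ∈ T i)
    (hy : x ∈ T j) : i = j := by
  by_contra h
  exact G.irrefl (hT.adj hx hy h)

theorem exists_notMem_of_card_lt {α : Type*} [Fintype α] [DecidableEq α] (F : Finset α)
    (h : F.card < Fintype.card α) : ∃ a, a ∉ F := by
  by_contra! hall
  rw [Finset.eq_univ_of_forall hall, Finset.card_univ] at h
  exact lt_irrefl _ h

/-- A vertex with neighbours in two parts of a complete multipartite graph with at least four parts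
has all its non-neighbours in a single part. -/
theorem IsMultipartite.nonadj_index_eq (hH : NoHalfJoinedK4 G) {S : Fin q → Set V}
    (hS : IsMultipartite G S) (hq : 4 ≤ q) {x a b c d : V} {i j k l : Fin q} (ha : a ∈ S i)
    (hb : b ∈ S j) (hc : c ∈ S k) (hd : d ∈ S l) (hij : i ≠ j) (hxa : G.Adj x a)
    (hxb : G.Adj x b) (hxc : ¬ G.Adj x c) (hxd : ¬ G.Adj x d) : k = l := by
  by_contra hkl
  -- With four different parts this is an HVN; coincidences are removed by a vertex `e` of a fresh
  -- part, which can serve as a neighbour or as a non-neighbour of `x`.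
  have bad : ∀ {i j k l : Fin q} {a b c d : V}, a ∈ S i → b ∈ S j → c ∈ S k → d ∈ S l →
      i ≠ j → i ≠ k → i ≠ l → j ≠ k → j ≠ l → k ≠ l → G.Adj x a → G.Adj x b → ¬ G.Adj x c →
      ¬ G.Adj x d → False := fun ha hb hc hd h1 h2 h3 h4 h5 h6 hxa hxb hxc hxd =>
    hH x _ _ _ _ (hS.adj ha hb h1) (hS.adj ha hc h2) (hS.adj ha hd h3) (hS.adj hb hc h4)
      (hS.adj hb hd h5) (hS.adj hc hd h6) hxa hxb hxc hxd
  obtain ⟨m, hm⟩ := exists_notMem_of_card_lt {i, j, k}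
    (by rw [Fintype.card_fin]; exact lt_of_le_of_lt Finset.card_le_three (by omega))
  have one : ∀ {i j l : Fin q} {a b c d : V}, a ∈ S i → b ∈ S j → c ∈ S i → d ∈ S l →
      i ≠ j → i ≠ l → j ≠ l → G.Adj x a → G.Adj x b → ¬ G.Adj x c → ¬ G.Adj x d → False := by
    intro i j l a b c d ha hb hc hd hij hil hjl hxa hxb hxc hxd
    obtain ⟨m, hm⟩ := exists_notMem_of_card_lt {i, j, l}
      (by rw [Fintype.card_fin]; exact lt_of_le_of_lt Finset.card_le_three (by omega))
    simp only [Finset.mem_insert, Finset.mem_singleton, not_or] at hm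
    obtain ⟨e, he⟩ := hS.nonempty m
    by_cases hxe : G.Adj x e
    · exact bad hb he hc hd (Ne.symm hm.2.1) hij.symm hjl hm.1 hm.2.2 hil hxb hxe hxc hxd
    · exact bad ha hb hd he hij hil (Ne.symm hm.1) hjl (Ne.symm hm.2.1) (Ne.symm hm.2.2)
        hxa hxb hxd hxe
  by_cases hik : i = k
  · subst hik
    by_cases hjl : j = l
    · subst hjl
      simp only [Finset.mem_insert, Finset.mem_singleton, not_or] at hm
      obtain ⟨e, he⟩ := hS.nonempty m
      by_cases hxe : G.Adj x e
      · exact one hb he hd hc (Ne.symm hm.2.1) hij.symm hm.1 hxb hxe hxd hxc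
      · exact one ha hb hc he hij (Ne.symm hm.1) (Ne.symm hm.2.1) hxa hxb hxc hxe
    · exact one ha hb hc hd hij hkl hjl hxa hxb hxc hxd
  · by_cases hil : i = l
    · subst hil
      by_cases hjk : j = k
      · subst hjk
        simp only [Finset.mem_insert, Finset.mem_singleton, not_or] at hm
        obtain ⟨e, he⟩ := hS.nonempty m
        by_cases hxe : G.Adj x e
        · exact one hb he hc hd (Ne.symm hm.2.1) hij.symm hm.1 hxb hxe hxc hxd
        · exact one ha hb hd he hij (Ne.symm hm.1) (Ne.symm hm.2.1) hxa hxb hxd hxe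
      · exact one ha hb hd hc hij hik hjk hxa hxb hxd hxc
    · by_cases hjk : j = k
      · subst hjk
        exact one hb ha hc hd hij.symm hkl hil hxb hxa hxc hxd
      · by_cases hjl : j = l
        · subst hjl
          exact one hb ha hd hc hij.symm hjk hik hxb hxa hxd hxc
        · exact bad ha hb hc hd hij hik hil hjk hjl hkl hxa hxb hxc hxd

theorem exists_two_notMem_of_card_lt {α : Type*} [Fintype α] [DecidableEq α] (F : Finset α)
    (h : F.card + 1 < Fintype.card α) : ∃ a b, a ≠ b ∧ a ∉ F ∧ b ∉ F := by
  obtain ⟨a, ha⟩ := exists_notMem_of_card_lt F (by omega)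
  obtain ⟨b, hb⟩ := exists_notMem_of_card_lt (insert a F)
    ((Finset.card_insert_le a F).trans_lt h)
  rw [Finset.mem_insert, not_or] at hb
  exact ⟨a, b, Ne.symm hb.1, ha, hb.2⟩

theorem mem_twinPart_self {U : Set V} {v : Fin q → V} (hvU : ∀ i, v i ∈ U)
    (hv : ∀ i j, i ≠ j → G.Adj (v i) (v j)) (i : Fin q) : v i ∈ twinPart G U v i :=
  ⟨hvU i, fun j => ⟨fun h => by rintro rfl; exact G.irrefl h, fun h => hv i j h.symm⟩⟩

/-- Adjacent vertices of one part would, with the other `q - 1` clique vertices, form a clique of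
size `q + 1`. If `x` and `y` in parts `i ≠ j` were nonadjacent, `y` would see exactly `v k`, `v l`
in the K₄ on `v k, v l, v j, x`. The set `U` is general because the lemma serves both the whole
graph and the part outside T. -/
theorem isMultipartite_twinPart (hH : NoHalfJoinedK4 G) {U : Set V} {v : Fin q → V} (hq : 4 ≤ q)
    (hvU : ∀ i, v i ∈ U) (hv : ∀ i j, i ≠ j → G.Adj (v i) (v j)) (hU : CliqueBoundOn G U q) :
    IsMultipartite G (twinPart G U v) := by
  classical
  refine ⟨fun i => ⟨v i, mem_twinPart_self hvU hv i⟩, ?_⟩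
  intro i j x y hx hy
  constructor
  · rintro hxy rfl
    have hinj : Function.Injective v := fun a b hab => by
      by_contra h
      exact (hv a b h).ne hab
    set t : Finset V := (Finset.univ.erase i).image v with ht
    have hmem : ∀ z ∈ t, ∃ k, k ≠ i ∧ v k = z := by
      intro z hz
      obtain ⟨k, hk, rfl⟩ := Finset.mem_image.1 hz
      exact ⟨k, Finset.ne_of_mem_erase hk, rfl⟩
    have hcard : t.card = q - 1 := by
      rw [ht, Finset.card_image_of_injective _ hinj, Finset.card_erase_of_mem (Finset.mem_univ i),
        Finset.card_univ, Fintype.card_fin]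
    have hxt : x ∉ t := fun h => by
      obtain ⟨k, hk, rfl⟩ := hmem x h
      exact G.irrefl ((hx.2 k).2 hk)
    have hyt : y ∉ t := fun h => by
      obtain ⟨k, hk, rfl⟩ := hmem y h
      exact G.irrefl ((hy.2 k).2 hk)
    have hcl : G.IsClique (t : Set V) := by
      intro a ha b hb hab
      obtain ⟨k, -, rfl⟩ := hmem a ha
      obtain ⟨l, -, rfl⟩ := hmem b hb
      exact hv k l (by rintro rfl; exact hab rfl)
    have := hU (insert x (insert y t)) (by
      intro z hz
      simp only [Finset.coe_insert, Set.mem_insert_iff, Finset.mem_coe] at hz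
      rcases hz with rfl | rfl | hz
      · exact hx.1
      · exact hy.1
      · obtain ⟨k, -, rfl⟩ := hmem z hz
        exact hvU k) (by
      rw [Finset.coe_insert, Finset.coe_insert]
      refine (hcl.insert ?_).insert ?_
      · intro b hb _
        obtain ⟨k, hk, rfl⟩ := hmem b hb
        exact (hy.2 k).2 hk
      · rintro b (rfl | hb) _
        · exact hxy
        · obtain ⟨k, hk, rfl⟩ := hmem b hb
          exact (hx.2 k).2 hk)
    rw [Finset.card_insert_of_notMem (by simp [hxt, hxy.ne]), Finset.card_insert_of_notMem hyt,
      hcard] at this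
    omega
  · intro hij
    by_contra hxy
    obtain ⟨k, l, hkl, hk, hl⟩ := exists_two_notMem_of_card_lt {i, j} (by
      rw [Fintype.card_fin]
      have := Finset.card_le_two (a := i) (b := j)
      omega)
    simp only [Finset.mem_insert, Finset.mem_singleton, not_or] at hk hl
    have hxj := (hx.2 j).2 hij.symm
    exact hH y (v k) (v l) (v j) x (hv k l hkl) (hv k j hk.2) ((hx.2 k).2 hk.1).symm
      (hv l j hl.2) ((hx.2 l).2 hl.1).symm hxj.symm ((hy.2 k).2 hk.2) ((hy.2 l).2 hl.2)
      (fun h => (hy.2 j).1 h rfl) (fun h => hxy h.symm)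

/-- A vertex seeing two parts has its non-neighbours in a single part, so it misses at most one `v
k`. Missing none gives too large a clique; missing one puts it into a part. -/
theorem hitsAtMostOne_twinPart (hH : NoHalfJoinedK4 G) {U : Set V} {v : Fin q → V} (hq : 4 ≤ q)
    (hvU : ∀ i, v i ∈ U) (hv : ∀ i j, i ≠ j → G.Adj (v i) (v j)) (hU : CliqueBoundOn G U q) {x : V}
    (hxU : x ∈ U) (hx : ∀ i, x ∉ twinPart G U v i) : HitsAtMostOne G (twinPart G U v) x := by
  classical
  have hM := isMultipartite_twinPart hH hq hvU hv hU
  intro i j s hs t ht hxs hxt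
  by_contra hij
  have hsingle : ∀ k l, ¬ G.Adj x (v k) → ¬ G.Adj x (v l) → k = l := fun k l hk hl =>
    hM.nonadj_index_eq hH hq hs ht (mem_twinPart_self hvU hv k) (mem_twinPart_self hvU hv l) hij
      hxs hxt hk hl
  by_cases hall : ∀ k, G.Adj x (v k)
  · have hinj : Function.Injective v := fun a b hab => by
      by_contra h
      exact (hv a b h).ne hab
    have hxv : x ∉ Finset.univ.image v := fun h => by
      obtain ⟨k, -, rfl⟩ := Finset.mem_image.1 h
      exact G.irrefl (hall k)
    have := hU (insert x (Finset.univ.image v)) (by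
      intro z hz
      simp only [Finset.coe_insert, Finset.coe_image, Set.mem_insert_iff] at hz
      rcases hz with rfl | ⟨k, -, rfl⟩
      · exact hxU
      · exact hvU k) (by
      rw [Finset.coe_insert]
      refine SimpleGraph.IsClique.insert ?_ ?_
      · intro a ha b hb hab
        obtain ⟨k, -, rfl⟩ := Finset.mem_image.1 (Finset.mem_coe.1 ha)
        obtain ⟨l, -, rfl⟩ := Finset.mem_image.1 (Finset.mem_coe.1 hb)
        exact hv k l (by rintro rfl; exact hab rfl)
      · intro b hb _
        obtain ⟨k, -, rfl⟩ := Finset.mem_image.1 (Finset.mem_coe.1 hb)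
        exact hall k)
    rw [Finset.card_insert_of_notMem hxv, Finset.card_image_of_injective _ hinj, Finset.card_univ,
      Fintype.card_fin] at this
    omega
  · push Not at hall
    obtain ⟨k, hk⟩ := hall
    refine hx k ⟨hxU, fun l => ⟨?_, fun hl => ?_⟩⟩
    · rintro hl rfl
      exact hk hl
    · by_contra hxl
      exact hl (hsingle l k hxl hk)

theorem exists_fin_of_isClique {t : Finset V} (ht : G.IsClique t) {q : ℕ} (hq : t.card = q) :
    ∃ v : Fin q → V, (∀ i, v i ∈ t) ∧ ∀ i j, i ≠ j → G.Adj (v i) (v j) := by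
  subst hq
  refine ⟨fun i => (t.equivFin.symm i : V), fun i => (t.equivFin.symm i).2, fun i j hij => ?_⟩
  refine ht (t.equivFin.symm i).2 (t.equivFin.symm j).2 fun h => hij ?_
  exact t.equivFin.symm.injective (Subtype.ext h)

end Multipartite

/-! ### Choosing parts that avoid a few labels -/

section Avoid

variable {n : ℕ}

theorem exists_some_notMem (F : Finset (Option (Fin n))) (h : F.card < n) :
    ∃ k : Fin n, some k ∉ F := by
  by_contra! hall
  have := Finset.card_le_card (s := Finset.univ.image (some : Fin n → Option (Fin n))) (t := F)
    (by
      intro o ho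
      obtain ⟨k, -, rfl⟩ := Finset.mem_image.1 ho
      exact hall k)
  rw [Finset.card_image_of_injective _ (Option.some_injective _), Finset.card_univ,
    Fintype.card_fin] at this
  omega

theorem exists_avoid_three (hn : 4 ≤ n) (a b c : Option (Fin n)) :
    ∃ k, a ≠ some k ∧ b ≠ some k ∧ c ≠ some k := by
  obtain ⟨k, hk⟩ := exists_some_notMem {a, b, c} (Finset.card_le_three.trans_lt (by omega))
  simp only [Finset.mem_insert, Finset.mem_singleton, not_or] at hk
  exact ⟨k, Ne.symm hk.1, Ne.symm hk.2.1, Ne.symm hk.2.2⟩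

theorem exists_avoid_four (hn : 5 ≤ n) (a b c d : Option (Fin n)) :
    ∃ k, a ≠ some k ∧ b ≠ some k ∧ c ≠ some k ∧ d ≠ some k := by
  obtain ⟨k, hk⟩ := exists_some_notMem {a, b, c, d} (Finset.card_le_four.trans_lt (by omega))
  simp only [Finset.mem_insert, Finset.mem_singleton, not_or] at hk
  exact ⟨k, Ne.symm hk.1, Ne.symm hk.2.1, Ne.symm hk.2.2.1, Ne.symm hk.2.2.2⟩

theorem exists_pair_avoid_two (hn : 4 ≤ n) (a b : Option (Fin n)) :
    ∃ k l, k ≠ l ∧ a ≠ some k ∧ b ≠ some k ∧ a ≠ some l ∧ b ≠ some l := by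
  obtain ⟨k, hk1, hk2, -⟩ := exists_avoid_three hn a b none
  obtain ⟨l, hl1, hl2, hl3⟩ := exists_avoid_three hn a b (some k)
  exact ⟨k, l, by simpa using hl3, hk1, hk2, hl1, hl2⟩

theorem exists_pair_avoid_three (hn : 5 ≤ n) (a b c : Option (Fin n)) :
    ∃ k l, k ≠ l ∧ a ≠ some k ∧ b ≠ some k ∧ c ≠ some k ∧ a ≠ some l ∧ b ≠ some l ∧
      c ≠ some l := by
  obtain ⟨k, hk1, hk2, hk3, -⟩ := exists_avoid_four hn a b c none
  obtain ⟨l, hl1, hl2, hl3, hl4⟩ := exists_avoid_four hn a b c (some k)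
  exact ⟨k, l, by simpa using hl4, hk1, hk2, hk3, hl1, hl2, hl3⟩

/-- Two indices avoid `some i`, `a` and `b`, unless these are three different indices out of at
most four. -/
theorem exists_pair_avoid_or (hn : 4 ≤ n) (i : Fin n) (a b : Option (Fin n)) :
    (∃ k l, k ≠ l ∧ some i ≠ some k ∧ a ≠ some k ∧ b ≠ some k ∧ some i ≠ some l ∧ a ≠ some l ∧
      b ≠ some l) ∨
    (n = 4 ∧ a ≠ none ∧ b ≠ none ∧ a ≠ some i ∧ b ≠ some i ∧ a ≠ b) := by
  by_cases h5 : 5 ≤ n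
  · exact Or.inl (exists_pair_avoid_three h5 _ a b)
  · by_cases h : a ≠ none ∧ b ≠ none ∧ a ≠ some i ∧ b ≠ some i ∧ a ≠ b
    · exact Or.inr ⟨by omega, h⟩
    · left
      by_cases h1 : a = none ∨ a = some i ∨ a = b
      · obtain ⟨k, l, hkl, h2, h3, h4, h6⟩ := exists_pair_avoid_two hn (some i) b
        refine ⟨k, l, hkl, h2, ?_, h3, h4, ?_, h6⟩ <;> rcases h1 with rfl | rfl | rfl <;>
          first | assumption | simp
      · obtain ⟨k, l, hkl, h2, h3, h4, h6⟩ := exists_pair_avoid_two hn (some i) a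
        have h7 : b = none ∨ b = some i := by tauto
        refine ⟨k, l, hkl, h2, h3, ?_, h4, h6, ?_⟩ <;> rcases h7 with rfl | rfl <;>
          first | assumption | simp

end Avoid

/-! ### Two multipartite graphs: forbidden configurations and cores -/

/-- Two disjoint induced complete multipartite graphs `T` and `S` in `G` such that a vertex outside
`T` has neighbours in at most one part of `T`, and a vertex outside both has neighbours in at most
one part of `S`. -/
structure TwoMultipartite {V : Type*} (G : SimpleGraph V) {n q : ℕ} (T : Fin n → Set V)
    (S : Fin q → Set V) : Prop where
  noPath : NoEdgeAndPath G
  noK4 : NoHalfJoinedK4 G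
  four_le : 4 ≤ q
  le : q ≤ n
  left : IsMultipartite G T
  right : IsMultipartite G S
  disjoint : ∀ {i j x}, x ∈ S i → x ∉ T j
  hits_left : ∀ {x}, (∀ i, x ∉ T i) → HitsAtMostOne G T x
  hits_right : ∀ {x}, (∀ i, x ∉ T i) → (∀ i, x ∉ S i) → HitsAtMostOne G S x

namespace TwoMultipartite

variable {V : Type*} {G : SimpleGraph V} {n q : ℕ} {T : Fin n → Set V} {S : Fin q → Set V}

/-- The vertex `x` lies in no part of `T` or `S`. -/
def Rest (T : Fin n → Set V) (S : Fin q → Set V) (x : V) : Prop :=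
  (∀ i, x ∉ T i) ∧ ∀ i, x ∉ S i

/-- An edge between two remaining vertices whose labels do not differ essentially. -/
structure Parallel (G : SimpleGraph V) (T : Fin n → Set V) (S : Fin q → Set V) (a : Fin n)
    (j : Fin q) (x y : V) : Prop where
  rest_left : Rest T S x
  rest_right : Rest T S y
  adj : G.Adj x y
  left_fst : label G T x = none ∨ label G T x = some a
  left_snd : label G T y = none ∨ label G T y = some a
  right_fst : label G S x = none ∨ label G S x = some j
  right_snd : label G S y = none ∨ label G S y = some j

/-- All vertices of `S` outside the part `j` have neighbours in no part of `T` but `i`. -/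
def Core (G : SimpleGraph V) (T : Fin n → Set V) (S : Fin q → Set V) (i : Fin n) (j : Fin q) :
    Prop :=
  ∀ k, k ≠ j → ∀ s ∈ S k, label G T s = none ∨ label G T s = some i

theorem Core.label_ne {i : Fin n} {j k : Fin q} {l : Fin n} (hc : Core G T S i j) (hk : k ≠ j)
    (hl : l ≠ i) {s : V} (hs : s ∈ S k) : label G T s ≠ some l := by
  rcases hc k hk s hs with e | e <;> rw [e] <;> simp [hl.symm]

section Basic

variable (h : TwoMultipartite G T S)
include h

theorem four_le' : 4 ≤ n := h.four_le.trans h.le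

theorem not_adj_right {s t : V} {i : Fin n} {j : Fin q} (hs : s ∈ S j) (ht : t ∈ T i)
    (hl : label G T s ≠ some i) : ¬ G.Adj s t :=
  (h.hits_left fun _ => h.disjoint hs).not_adj ht hl

theorem label_right {s t : V} {i : Fin n} {j : Fin q} (hs : s ∈ S j) (ht : t ∈ T i)
    (hst : G.Adj s t) : label G T s = some i :=
  (h.hits_left fun _ => h.disjoint hs).label_eq ht hst

/-- The edge `s s'` of S against the induced path `u t x y`, where `u` is any vertex of `T k`; the
label conditions make them anticomplete. -/
theorem false_of_left_path {x y t s s' : V} {i k : Fin n} {j j' : Fin q} (hx : Rest T S x)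
    (hy : Rest T S y) (hxy : G.Adj x y) (hik : i ≠ k) (ht : t ∈ T i) (htx : G.Adj t x)
    (hty : ¬ G.Adj t y) (hxk : label G T x ≠ some k) (hyk : label G T y ≠ some k)
    (hs : s ∈ S j) (hs' : s' ∈ S j') (hj : j ≠ j') (hxj : label G S x ≠ some j)
    (hxj' : label G S x ≠ some j') (hyj : label G S y ≠ some j) (hyj' : label G S y ≠ some j')
    (hsi : label G T s ≠ some i) (hsk : label G T s ≠ some k) (hsi' : label G T s' ≠ some i)
    (hsk' : label G T s' ≠ some k) : False := by
  obtain ⟨u, hu⟩ := h.left.nonempty k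
  have hx1 := h.hits_left hx.1
  have hy1 := h.hits_left hy.1
  have hx2 := h.hits_right hx.1 hx.2
  have hy2 := h.hits_right hy.1 hy.2
  exact h.noPath s s' u t x y (h.right.adj hs hs' hj) (h.left.adj hu ht hik.symm) htx hxy
    (fun e => hx1.not_adj hu hxk e.symm) hty (fun e => hy1.not_adj hu hyk e.symm)
    (h.not_adj_right hs hu hsk) (h.not_adj_right hs ht hsi)
    (fun e => hx2.not_adj hs hxj e.symm) (fun e => hy2.not_adj hs hyj e.symm)
    (h.not_adj_right hs' hu hsk') (h.not_adj_right hs' ht hsi')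
    (fun e => hx2.not_adj hs' hxj' e.symm) (fun e => hy2.not_adj hs' hyj' e.symm)

/-- The mirror image: an edge between `T k` and `T k'` against the path `s' s x y`. -/
theorem false_of_right_path {x y s s' : V} {k k' : Fin n} {j j' : Fin q} (hx : Rest T S x)
    (hy : Rest T S y) (hxy : G.Adj x y) (hj : j ≠ j') (hs : s ∈ S j) (hsx : G.Adj s x)
    (hsy : ¬ G.Adj s y) (hs' : s' ∈ S j') (hxj' : label G S x ≠ some j')
    (hyj' : label G S y ≠ some j') (hk : k ≠ k') (hxk : label G T x ≠ some k)
    (hyk : label G T y ≠ some k) (hsk : label G T s ≠ some k) (hsk1 : label G T s' ≠ some k)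
    (hxk' : label G T x ≠ some k') (hyk' : label G T y ≠ some k') (hsk' : label G T s ≠ some k')
    (hsk1' : label G T s' ≠ some k') : False := by
  obtain ⟨u, hu⟩ := h.left.nonempty k
  obtain ⟨u', hu'⟩ := h.left.nonempty k'
  have hx1 := h.hits_left hx.1
  have hy1 := h.hits_left hy.1
  have hx2 := h.hits_right hx.1 hx.2
  have hy2 := h.hits_right hy.1 hy.2
  exact h.noPath u u' s' s x y (h.left.adj hu hu' hk) (h.right.adj hs' hs hj.symm) hsx hxy
    (fun e => hx2.not_adj hs' hxj' e.symm) hsy (fun e => hy2.not_adj hs' hyj' e.symm)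
    (fun e => h.not_adj_right hs' hu hsk1 e.symm) (fun e => h.not_adj_right hs hu hsk e.symm)
    (fun e => hx1.not_adj hu hxk e.symm) (fun e => hy1.not_adj hu hyk e.symm)
    (fun e => h.not_adj_right hs' hu' hsk1' e.symm) (fun e => h.not_adj_right hs hu' hsk' e.symm)
    (fun e => hx1.not_adj hu' hxk' e.symm) (fun e => hy1.not_adj hu' hyk' e.symm)

/-- If at least three parts of `T` miss the edge `x y`, then the parts of `T` and the parts of `S`
that miss it are anticomplete, or a vertex of one of the former is complete to all of the latter. -/
theorem anticomplete_or_complete {x y : V} (hx : Rest T S x) (hy : Rest T S y)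
    (hxy : G.Adj x y)
    (hF : ∀ i : Fin n, ∃ k l, k ≠ l ∧ k ≠ i ∧ l ≠ i ∧ label G T x ≠ some k ∧ label G T y ≠ some k ∧
      label G T x ≠ some l ∧ label G T y ≠ some l) :
    (∀ i, label G T x ≠ some i → label G T y ≠ some i → ∀ j, label G S x ≠ some j →
      label G S y ≠ some j → ∀ s ∈ S j, label G T s ≠ some i) ∨
    ∃ i, label G T x ≠ some i ∧ label G T y ≠ some i ∧ ∃ t ∈ T i, ∀ j, label G S x ≠ some j →
      label G S y ≠ some j → ∀ s ∈ S j, G.Adj t s := by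
  have hx1 := h.hits_left hx.1
  have hy1 := h.hits_left hy.1
  have hx2 := h.hits_right hx.1 hx.2
  have hy2 := h.hits_right hy.1 hy.2
  rw [or_iff_not_imp_left]
  intro hno
  push Not at hno
  obtain ⟨i, hxi, hyi, j, hxj, hyj, s, hs, hsi⟩ := hno
  obtain ⟨t, ht, hst⟩ := exists_adj_of_label hsi
  refine ⟨i, hxi, hyi, t, ht, ?_⟩
  -- If `t` saw `s` but not `s'`, the edge `x y` would be anticomplete to a path `u t s s'` with `u`
  -- in a part of `T` missed by `x`, `y` and `s'`.
  have main : ∀ {j j' : Fin q} {s s' : V}, label G S x ≠ some j → label G S y ≠ some j →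
      label G S x ≠ some j' → label G S y ≠ some j' → j ≠ j' → s ∈ S j → s' ∈ S j' → G.Adj s t →
      G.Adj t s' := by
    intro j j' s s' hxj hyj hxj' hyj' hjj hs hs' hst
    by_contra hts'
    have hsi := h.label_right hs ht hst
    obtain ⟨k, hki, hxk, hyk, hsk⟩ : ∃ k, k ≠ i ∧ label G T x ≠ some k ∧ label G T y ≠ some k ∧
        label G T s' ≠ some k := by
      obtain ⟨k, l, hkl, hki, hli, h1, h2, h3, h4⟩ := hF i
      by_cases hk : label G T s' = some k
      · refine ⟨l, hli, h3, h4, ?_⟩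
        rw [hk]
        simpa using hkl
      · exact ⟨k, hki, h1, h2, hk⟩
    obtain ⟨u, hu⟩ := h.left.nonempty k
    have hsk0 : label G T s ≠ some k := by rw [hsi]; simpa using hki.symm
    exact h.noPath x y u t s s' hxy (h.left.adj hu ht hki) hst.symm (h.right.adj hs hs' hjj)
      (fun e => h.not_adj_right hs hu hsk0 e.symm) hts'
      (fun e => h.not_adj_right hs' hu hsk e.symm)
      (hx1.not_adj hu hxk) (hx1.not_adj ht hxi) (hx2.not_adj hs hxj) (hx2.not_adj hs' hxj')
      (hy1.not_adj hu hyk) (hy1.not_adj ht hyi) (hy2.not_adj hs hyj) (hy2.not_adj hs' hyj')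
  intro j' hxj' hyj' s' hs'
  by_cases hjj : j = j'
  · subst hjj
    -- Vertices in the part of `s` itself are reached by a detour through another missed part.
    obtain ⟨l, hxl, hyl, hjl⟩ := exists_avoid_three h.four_le (label G S x) (label G S y) (some j)
    obtain ⟨u, hu⟩ := h.right.nonempty l
    have hjl' : j ≠ l := by simpa using hjl
    exact main hxl hyl hxj hyj hjl'.symm hu hs' (main hxj hyj hxl hyl hjl' hs hu hst).symm
  · exact main hxj hyj hxj' hyj' hjj hs hs' hst

/-- A parallel edge misses all parts of T but `a` and all parts of S but `j`. The anticomplete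
alternative makes `a` the core index; the complete one gives the part containing `t`. -/
theorem Parallel.exists_core {a : Fin n} {j : Fin q} {x y : V} (hp : Parallel G T S a j x y) :
    ∃ i, Core G T S i j := by
  have hF : ∀ k, k ≠ a → label G T x ≠ some k ∧ label G T y ≠ some k := by
    intro k hk
    constructor
    · rcases hp.left_fst with e | e <;> rw [e] <;> simp [hk.symm]
    · rcases hp.left_snd with e | e <;> rw [e] <;> simp [hk.symm]
  have hF' : ∀ k, k ≠ j → label G S x ≠ some k ∧ label G S y ≠ some k := by
    intro k hk
    constructor
    · rcases hp.right_fst with e | e <;> rw [e] <;> simp [hk.symm]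
    · rcases hp.right_snd with e | e <;> rw [e] <;> simp [hk.symm]
  rcases h.anticomplete_or_complete hp.rest_left hp.rest_right hp.adj (by
    intro i
    obtain ⟨k, l, hkl, h1, h2, h3, h4⟩ := exists_pair_avoid_two h.four_le' (some a) (some i)
    simp only [ne_eq, Option.some.injEq] at h1 h2 h3 h4
    have := hF k (Ne.symm h1)
    have := hF l (Ne.symm h3)
    exact ⟨k, l, hkl, Ne.symm h2, Ne.symm h4, by tauto, by tauto, by tauto, by tauto⟩) with
    hN | ⟨i, -, -, t, ht, hN⟩
  · refine ⟨a, fun k hk s hs => ?_⟩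
    rcases hs' : label G T s with _ | c
    · exact Or.inl rfl
    · right
      by_contra hc
      have hca : c ≠ a := fun e => hc (by rw [e])
      exact hN c (hF c hca).1 (hF c hca).2 k (hF' k hk).1 (hF' k hk).2 s hs hs'
  · exact ⟨i, fun k hk s hs => Or.inr (h.label_right hs ht
      (hN k (hF' k hk).1 (hF' k hk).2 s hs).symm)⟩

end Basic

end TwoMultipartite
-- Edges outside T and S relative to a core
namespace TwoMultipartite

variable {V : Type*} {G : SimpleGraph V} {n q : ℕ} {T : Fin n → Set V} {S : Fin q → Set V}

/-- The labels of the edge `x y` are essentially different from each other and from `i`, `j`. -/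
structure Twisted (G : SimpleGraph V) (T : Fin n → Set V) (S : Fin q → Set V) (i : Fin n)
    (j : Fin q) (x y : V) : Prop where
  left_fst_ne_none : label G T x ≠ none
  left_snd_ne_none : label G T y ≠ none
  left_fst : label G T x ≠ some i
  left_snd : label G T y ≠ some i
  left : label G T x ≠ label G T y
  right_fst_ne_none : label G S x ≠ none
  right_snd_ne_none : label G S y ≠ none
  right_fst : label G S x ≠ some j
  right_snd : label G S y ≠ some j
  right : label G S x ≠ label G S y

section Edges

variable (h : TwoMultipartite G T S)
include h

/-- If `w` missed a neighbour `t ∈ T c` of `z`, there would be a path `u t z w` with `u ∈ T m`.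
Since `c` and `m` differ from `i`, the core makes an edge between `S k` and `S l` anticomplete to
it. -/
theorem Core.left_eq_of_ne {i : Fin n} {j : Fin q} (hc : Core G T S i j) {z w : V}
    (hz : Rest T S z) (hw : Rest T S w) (hzw : G.Adj z w)
    (hF : ∃ k l, k ≠ l ∧ some j ≠ some k ∧ label G S z ≠ some k ∧ label G S w ≠ some k ∧
      some j ≠ some l ∧ label G S z ≠ some l ∧ label G S w ≠ some l)
    {c : Fin n} (hci : c ≠ i) (hzc : label G T z = some c) : label G T w = some c := by
  obtain ⟨k, l, hkl, hjk, hzk, hwk, hjl, hzl, hwl⟩ := hF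
  obtain ⟨t, ht, hzt⟩ := exists_adj_of_label hzc
  by_cases hwt : G.Adj w t
  · exact (h.hits_left hw.1).label_eq ht hwt
  · exfalso
    obtain ⟨s, hs⟩ := h.right.nonempty k
    obtain ⟨s', hs'⟩ := h.right.nonempty l
    have hk : k ≠ j := fun e => hjk (by rw [e])
    have hl : l ≠ j := fun e => hjl (by rw [e])
    obtain ⟨m, hm1, hm2, hm3⟩ := exists_avoid_three h.four_le' (some c) (some i) (label G T w)
    have hcm : c ≠ m := fun e => hm1 (by rw [e])
    have him : m ≠ i := fun e => hm2 (by rw [e])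
    exact h.false_of_left_path hz hw hzw hcm ht hzt.symm (fun e => hwt e.symm)
      (by rw [hzc]; exact hm1) hm3 hs hs' hkl hzk hzl hwk hwl (hc.label_ne hk hci hs)
      (hc.label_ne hk him hs) (hc.label_ne hl hci hs') (hc.label_ne hl him hs')

theorem Core.right_eq_of_ne {i : Fin n} {j : Fin q} (hc : Core G T S i j) {z w : V}
    (hz : Rest T S z) (hw : Rest T S w) (hzw : G.Adj z w)
    (hF : ∃ k l, k ≠ l ∧ some i ≠ some k ∧ label G T z ≠ some k ∧ label G T w ≠ some k ∧
      some i ≠ some l ∧ label G T z ≠ some l ∧ label G T w ≠ some l)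
    {c : Fin q} (hcj : c ≠ j) (hzc : label G S z = some c) : label G S w = some c := by
  obtain ⟨k, l, hkl, hik, hzk, hwk, hil, hzl, hwl⟩ := hF
  obtain ⟨s, hs, hzs⟩ := exists_adj_of_label hzc
  by_cases hws : G.Adj w s
  · exact (h.hits_right hw.1 hw.2).label_eq hs hws
  · exfalso
    have hk : k ≠ i := fun e => hik (by rw [e])
    have hl : l ≠ i := fun e => hil (by rw [e])
    obtain ⟨m, hm1, hm2, hm3⟩ := exists_avoid_three h.four_le (some c) (some j) (label G S w)
    have hcm : c ≠ m := fun e => hm1 (by rw [e])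
    have hjm : m ≠ j := fun e => hm2 (by rw [e])
    obtain ⟨s', hs'⟩ := h.right.nonempty m
    exact h.false_of_right_path hz hw hzw hcm hs hzs.symm (fun e => hws e.symm) hs'
      (by rw [hzc]; exact hm1) hm3 hkl hzk hwk (hc.label_ne hcj hk hs) (hc.label_ne hjm hk hs')
      hzl hwl (hc.label_ne hcj hl hs) (hc.label_ne hjm hl hs')

omit h in
-- The propagation arguments are silent about the core index itself, so having no label is merged
-- with having label `i`.
theorem getD_eq_of_forall {m : ℕ} {i : Fin m} {a b : Option (Fin m)}
    (hab : ∀ c, c ≠ i → a = some c → b = some c) (hba : ∀ c, c ≠ i → b = some c → a = some c) :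
    a.getD i = b.getD i := by
  rcases a with _ | a <;> rcases b with _ | b
  · rfl
  · by_contra hne
    simpa using hba b (fun e => hne (by simp [e])) rfl
  · by_contra hne
    simpa using hab a (fun e => hne (by simp [e])) rfl
  · by_cases ha : a = i
    · by_contra hne
      have := hba b (fun e => hne (by simp [e, ha])) rfl
      exact hne (by rw [this])
    · have := hab a ha rfl
      rw [this]

/-- Relative to a core, the edges outside `T` and `S` respect the labels, or they are twisted. -/
theorem Core.getD_eq_or_twisted {i : Fin n} {j : Fin q} (hc : Core G T S i j) {z w : V}
    (hz : Rest T S z) (hw : Rest T S w) (hzw : G.Adj z w) :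
    ((label G T z).getD i = (label G T w).getD i ∧ (label G S z).getD j = (label G S w).getD j) ∨
      (n = 4 ∧ q = 4 ∧ Twisted G T S i j z w) := by
  have hrow : (∃ k l, k ≠ l ∧ some i ≠ some k ∧ label G T z ≠ some k ∧ label G T w ≠ some k ∧
      some i ≠ some l ∧ label G T z ≠ some l ∧ label G T w ≠ some l) →
      (label G S z).getD j = (label G S w).getD j := by
    rintro ⟨k, l, h1, h2, h3, h4, h5, h6, h7⟩
    exact getD_eq_of_forall
      (fun c hcj e => hc.right_eq_of_ne h hz hw hzw ⟨k, l, h1, h2, h3, h4, h5, h6, h7⟩ hcj e)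
      (fun c hcj e => hc.right_eq_of_ne h hw hz hzw.symm ⟨k, l, h1, h2, h4, h3, h5, h7, h6⟩ hcj e)
  have hcol : (∃ k l, k ≠ l ∧ some j ≠ some k ∧ label G S z ≠ some k ∧ label G S w ≠ some k ∧
      some j ≠ some l ∧ label G S z ≠ some l ∧ label G S w ≠ some l) →
      (label G T z).getD i = (label G T w).getD i := by
    rintro ⟨k, l, h1, h2, h3, h4, h5, h6, h7⟩
    exact getD_eq_of_forall
      (fun c hcj e => hc.left_eq_of_ne h hz hw hzw ⟨k, l, h1, h2, h3, h4, h5, h6, h7⟩ hcj e)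
      (fun c hcj e => hc.left_eq_of_ne h hw hz hzw.symm ⟨k, l, h1, h2, h4, h3, h5, h7, h6⟩ hcj e)
  -- Equal merged labels rule out three different indices, so two parts of S are missed and the
  -- T-labels agree too.
  have hcol_of : (label G S z).getD j = (label G S w).getD j →
      (label G T z).getD i = (label G T w).getD i := by
    intro e
    refine hcol ((exists_pair_avoid_or h.four_le j (label G S z) (label G S w)).resolve_right ?_)
    rintro ⟨-, h1, h2, h3, h4, h5⟩
    rcases hz' : label G S z with _ | a <;> rcases hw' : label G S w with _ | b <;> simp_all
  rcases exists_pair_avoid_or h.four_le' i (label G T z) (label G T w) with hr | hr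
  · exact Or.inl ⟨hcol_of (hrow hr), hrow hr⟩
  · rcases exists_pair_avoid_or h.four_le j (label G S z) (label G S w) with hk | hk
    · exfalso
      have e := hcol hk
      obtain ⟨-, h1, h2, h3, h4, h5⟩ := hr
      rcases hz' : label G T z with _ | a <;> rcases hw' : label G T w with _ | b <;> simp_all
    · exact Or.inr ⟨hr.1, hk.1, hr.2.1, hr.2.2.1, hr.2.2.2.1, hr.2.2.2.2.1, hr.2.2.2.2.2, hk.2.1,
        hk.2.2.1, hk.2.2.2.1, hk.2.2.2.2.1, hk.2.2.2.2.2⟩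

/-- An end of a parallel edge has S-label `j` or none, while `z` has another one; an edge between
them would neither respect the labels nor be twisted. -/
theorem Parallel.not_adj_of_twisted {i a : Fin n} {j : Fin q} (hc : Core G T S i j) {x y z w : V}
    (hp : Parallel G T S a j x y) (hz : Rest T S z)
    (ht : Twisted G T S i j z w) : ¬ G.Adj x z ∧ ¬ G.Adj y z := by
  have key : ∀ u, Rest T S u → (label G S u = none ∨ label G S u = some j) → ¬ G.Adj u z := by
    intro u hu hu' huz
    rcases hc.getD_eq_or_twisted h hu hz huz with ⟨-, e⟩ | ⟨-, -, e⟩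
    · have h1 := ht.right_fst_ne_none
      have h2 := ht.right_fst
      rcases hz' : label G S z with _ | b
      · exact h1 hz'
      · rcases hu' with e' | e' <;> simp_all
    · rcases hu' with e' | e'
      · exact e.right_fst_ne_none e'
      · exact e.right_fst e'
  exact ⟨key x hp.rest_left hp.right_fst, key y hp.rest_right hp.right_snd⟩

omit h in
theorem Twisted.symm {i : Fin n} {j : Fin q} {z w : V} (ht : Twisted G T S i j z w) :
    Twisted G T S i j w z :=
  ⟨ht.left_snd_ne_none, ht.left_fst_ne_none, ht.left_snd, ht.left_fst, ht.left.symm,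
    ht.right_snd_ne_none, ht.right_fst_ne_none, ht.right_snd, ht.right_fst, ht.right.symm⟩

/-- The parallel edge is anticomplete to an induced path `u t z w` starting in two parts of T other
than `a`; if `z` has label `a`, then `w` does not and the roles are exchanged. -/
theorem Parallel.false_of_twisted {i a : Fin n} {j : Fin q} (hc : Core G T S i j) {x y z w : V}
    (hp : Parallel G T S a j x y) (hz : Rest T S z) (hw : Rest T S w) (hzw : G.Adj z w)
    (ht : Twisted G T S i j z w) : False := by
  have hxz := hp.not_adj_of_twisted h hc hz ht
  have hxw := hp.not_adj_of_twisted h hc hw ht.symm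
  have key : ∀ {z w : V}, Rest T S z → Rest T S w → G.Adj z w → label G T z ≠ none →
      label G T z ≠ label G T w → label G T z ≠ some a → ¬ G.Adj x z → ¬ G.Adj y z →
      ¬ G.Adj x w → ¬ G.Adj y w → False := by
    intro z w hz hw hzw hne hne' hza hxz hyz hxw hyw
    obtain ⟨c, hzc⟩ := Option.ne_none_iff_exists'.1 hne
    obtain ⟨t, htc, hzt⟩ := exists_adj_of_label hzc
    obtain ⟨k, hk1, hk2, hk3⟩ := exists_avoid_three h.four_le' (some c) (label G T w) (some a)
    obtain ⟨u, hu⟩ := h.left.nonempty k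
    have hck : c ≠ k := fun e => hk1 (by rw [e])
    have hwt : ¬ G.Adj w t := fun e =>
      hne' (by rw [hzc, (h.hits_left hw.1).label_eq htc e])
    have hlab : ∀ {v}, (label G T v = none ∨ label G T v = some a) →
        label G T v ≠ some k ∧ label G T v ≠ some c := by
      rintro v (e | e) <;> rw [e]
      · simp
      · exact ⟨hk3, fun e' => hza (by rw [hzc, e'])⟩
    have hx1 := h.hits_left hp.rest_left.1
    have hy1 := h.hits_left hp.rest_right.1
    exact h.noPath x y u t z w hp.adj (h.left.adj hu htc hck.symm) hzt.symm hzw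
      (fun e => (h.hits_left hz.1).not_adj hu (by rw [hzc]; exact hk1) e.symm)
      (fun e => hwt e.symm)
      (fun e => (h.hits_left hw.1).not_adj hu hk2 e.symm)
      (hx1.not_adj hu (hlab hp.left_fst).1) (hx1.not_adj htc (hlab hp.left_fst).2) hxz hxw
      (hy1.not_adj hu (hlab hp.left_snd).1) (hy1.not_adj htc (hlab hp.left_snd).2) hyz hyw
  by_cases hza : label G T z = some a
  · exact key hw hz hzw.symm ht.left_snd_ne_none ht.left.symm
      (fun e => ht.left (by rw [hza, e])) hxw.1 hxw.2 hxz.1 hxz.2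
  · exact key hz hw hzw ht.left_fst_ne_none ht.left hza hxz.1 hxz.2 hxw.1 hxw.2

/-- If there is a parallel edge, then all edges outside `T` and `S` respect the labels relative to
some core. -/
theorem Parallel.exists_core_forall {a : Fin n} {j : Fin q} {x y : V}
    (hp : Parallel G T S a j x y) :
    ∃ i, Core G T S i j ∧ ∀ z w, Rest T S z → Rest T S w → G.Adj z w →
      (label G T z).getD i = (label G T w).getD i ∧
        (label G S z).getD j = (label G S w).getD j := by
  obtain ⟨i, hc⟩ := hp.exists_core h
  refine ⟨i, hc, fun z w hz hw hzw => ?_⟩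
  exact (hc.getD_eq_or_twisted h hz hw hzw).resolve_right
    fun ht => hp.false_of_twisted h hc hz hw hzw ht.2.2

end Edges

end TwoMultipartite
-- Edges with two different labels
namespace TwoMultipartite

variable {V : Type*} {G : SimpleGraph V} {n q : ℕ} {T : Fin n → Set V} {S : Fin q → Set V}

section Crossing

variable (h : TwoMultipartite G T S)
include h

/-- If an edge has only one label in `T`, then it has only one label in `S`. -/
theorem right_label_eq {x y : V} (hx : Rest T S x) (hy : Rest T S y) (hxy : G.Adj x y) {a : Fin n}
    (hxa : label G T x = none ∨ label G T x = some a)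
    (hya : label G T y = none ∨ label G T y = some a) {u v : Fin q} (hxu : label G S x = some u)
    (hyv : label G S y = some v) : u = v := by
  by_contra huv
  have hF : ∀ k, some a ≠ some k → label G T x ≠ some k ∧ label G T y ≠ some k := by
    intro k hk
    constructor
    · rcases hxa with e | e <;> rw [e] <;> first | exact hk | simp
    · rcases hya with e | e <;> rw [e] <;> first | exact hk | simp
  obtain ⟨s, hs, hxs⟩ := exists_adj_of_label hxu
  obtain ⟨s', hs', hys'⟩ := exists_adj_of_label hyv
  have hys : ¬ G.Adj y s := (h.hits_right hy.1 hy.2).not_adj hs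
    (by rw [hyv]; simpa using Ne.symm huv)
  have hxs' : ¬ G.Adj x s' := (h.hits_right hx.1 hx.2).not_adj hs'
    (by rw [hxu]; simpa using huv)
  obtain ⟨m, m', hmm, hxm, hym, hxm', hym'⟩ :=
    exists_pair_avoid_two h.four_le (label G S x) (label G S y)
  have hum : u ≠ m := fun e => hxm (by rw [hxu, e])
  have hvm : v ≠ m := fun e => hym (by rw [hyv, e])
  obtain ⟨p, hp⟩ := h.right.nonempty m
  obtain ⟨p', hp'⟩ := h.right.nonempty m'
  rcases h.anticomplete_or_complete hx hy hxy (by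
    intro i
    obtain ⟨k, l, hkl, h1, h2, h3, h4⟩ := exists_pair_avoid_two h.four_le' (some a) (some i)
    have hk := hF k h1
    have hl := hF l h3
    exact ⟨k, l, hkl, fun e => h2 (by rw [e]), fun e => h4 (by rw [e]), hk.1, hk.2, hl.1, hl.2⟩)
    with hN | ⟨i, -, -, t, ht, hN⟩
  · obtain ⟨k, l, hkl, h1, h2, h3, h4⟩ :=
      exists_pair_avoid_two h.four_le' (some a) (label G T s)
    have hk := hF k h1
    have hl := hF l h3
    exact h.false_of_right_path hx hy hxy hum hs hxs.symm (fun e => hys e.symm) hp hxm hym hkl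
      hk.1 hk.2 h2 (hN k hk.1 hk.2 m hxm hym p hp) hl.1 hl.2 h4
      (hN l hl.1 hl.2 m hxm hym p hp)
  · have hip := h.label_right hp ht (hN m hxm hym p hp).symm
    obtain ⟨k, l, hkl, h1, h2, h3, h4⟩ := exists_pair_avoid_two h.four_le' (some a) (some i)
    have hk := hF k h1
    have hl := hF l h3
    -- Seeing two parts of S, `t` cannot miss both `s` and `s'`. Whichever it sees shares the label
    -- `i` with `p`, so two parts of T stay free of the path.
    have hss : ¬ (¬ G.Adj t s ∧ ¬ G.Adj t s') := fun e =>
      huv (h.right.nonadj_index_eq h.noK4 h.four_le hp hp' hs hs' hmm (hN m hxm hym p hp)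
        (hN m' hxm' hym' p' hp') e.1 e.2)
    by_cases hts : G.Adj t s
    · have his := h.label_right hs ht hts.symm
      exact h.false_of_right_path hx hy hxy hum hs hxs.symm (fun e => hys e.symm) hp hxm hym hkl
        hk.1 hk.2 (by rwa [his]) (by rwa [hip]) hl.1 hl.2 (by rwa [his]) (by rwa [hip])
    · have hts' : G.Adj t s' := by tauto
      have his := h.label_right hs' ht hts'.symm
      exact h.false_of_right_path hy hx hxy.symm hvm hs' hys'.symm (fun e => hxs' e.symm) hp hym
        hxm hkl hk.2 hk.1 (by rwa [his]) (by rwa [hip]) hl.2 hl.1 (by rwa [his]) (by rwa [hip])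

/-- If an edge has two different labels `a`, `b` in `T`, then the labels of two vertices in
different parts of `S` missed by the edge are `a`, `b`, or they are any two other labels. -/
theorem labels_of_edge {x y : V} (hx : Rest T S x) (hy : Rest T S y) (hxy : G.Adj x y)
    {a b : Fin n} (hab : a ≠ b) (hxa : label G T x = some a) (hyb : label G T y = some b)
    {k k' : Fin n} (hkk : k ≠ k') (hak : a ≠ k) (hbk : b ≠ k) (hak' : a ≠ k') (hbk' : b ≠ k')
    {j j' : Fin q} (hjj : j ≠ j') (hxj : label G S x ≠ some j) (hyj : label G S y ≠ some j)
    (hxj' : label G S x ≠ some j') (hyj' : label G S y ≠ some j') {s s' : V} (hs : s ∈ S j)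
    (hs' : s' ∈ S j') :
    (label G T s = some a ∧ label G T s' = some b) ∨
    (label G T s = some b ∧ label G T s' = some a) ∨
    (label G T s = some k ∧ label G T s' = some k') ∨
    (label G T s = some k' ∧ label G T s' = some k) := by
  obtain ⟨t, ht, hxt⟩ := exists_adj_of_label hxa
  obtain ⟨u, hu, hyu⟩ := exists_adj_of_label hyb
  have hyt : ¬ G.Adj t y := fun e => (h.hits_left hy.1).not_adj ht
    (by rw [hyb]; simpa using hab.symm) e.symm
  have hxu : ¬ G.Adj u x := fun e => (h.hits_left hx.1).not_adj hu
    (by rw [hxa]; simpa using hab) e.symm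
  -- For each `l` outside `{a, b}`, the two labels of `s, s'` meet `{a, l}` and `{b, l}`. Taking `l
  -- = k` and `l = k'` leaves only `{a, b}` and `{k, k'}`.
  have hita : ∀ l, a ≠ l → b ≠ l → label G T s = some a ∨ label G T s = some l ∨
      label G T s' = some a ∨ label G T s' = some l := by
    intro l hal hbl
    by_contra! hcon
    exact h.false_of_left_path hx hy hxy hal ht hxt.symm hyt (by rw [hxa]; simpa using hal)
      (by rw [hyb]; simpa using hbl) hs hs' hjj hxj hxj' hyj hyj' hcon.1 hcon.2.1 hcon.2.2.1
      hcon.2.2.2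
  have hitb : ∀ l, a ≠ l → b ≠ l → label G T s = some b ∨ label G T s = some l ∨
      label G T s' = some b ∨ label G T s' = some l := by
    intro l hal hbl
    by_contra! hcon
    exact h.false_of_left_path hy hx hxy.symm hbl hu hyu.symm hxu (by rw [hyb]; simpa using hbl)
      (by rw [hxa]; simpa using hal) hs hs' hjj hyj hyj' hxj hxj' hcon.1 hcon.2.1 hcon.2.2.1
      hcon.2.2.2
  have h1 := hita k hak hbk
  have h2 := hita k' hak' hbk'
  have h3 := hitb k hak hbk
  have h4 := hitb k' hak' hbk'
  generalize label G T s = o at *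
  generalize label G T s' = o' at *
  have e1 : some a ≠ some b := by simpa using hab
  have e2 : some k ≠ some k' := by simpa using hkk
  have e3 : some a ≠ some k := by simpa using hak
  have e4 : some b ≠ some k := by simpa using hbk
  have e5 : some a ≠ some k' := by simpa using hak'
  have e6 : some b ≠ some k' := by simpa using hbk'
  grind

/-- If an edge has only one label in `S`, then it has only one label in `T`. -/
theorem left_label_eq {x y : V} (hx : Rest T S x) (hy : Rest T S y) (hxy : G.Adj x y) {j : Fin q}
    (hxj : label G S x = none ∨ label G S x = some j)
    (hyj : label G S y = none ∨ label G S y = some j) {a b : Fin n} (hxa : label G T x = some a)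
    (hyb : label G T y = some b) : a = b := by
  by_contra hab
  have hF : ∀ k, some j ≠ some k → label G S x ≠ some k ∧ label G S y ≠ some k := by
    intro k hk
    constructor
    · rcases hxj with e | e <;> rw [e] <;> first | exact hk | simp
    · rcases hyj with e | e <;> rw [e] <;> first | exact hk | simp
  obtain ⟨k, k', hkk, h1, h2, h3, h4⟩ := exists_pair_avoid_two h.four_le' (some a) (some b)
  obtain ⟨m, m', hmm, h5, -, h6, -⟩ := exists_pair_avoid_two h.four_le (some j) none
  obtain ⟨l, h7, h8, h9⟩ := exists_avoid_three h.four_le (some j) (some m) (some m')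
  obtain ⟨s, hs⟩ := h.right.nonempty m
  obtain ⟨s', hs'⟩ := h.right.nonempty m'
  obtain ⟨r, hr⟩ := h.right.nonempty l
  have key := fun {j j' : Fin q} (hjj : j ≠ j') hj hj' {s s' : V} (hs : s ∈ S j)
      (hs' : s' ∈ S j') => h.labels_of_edge hx hy hxy hab hxa hyb hkk (fun e => h1 (by rw [e]))
    (fun e => h2 (by rw [e])) (fun e => h3 (by rw [e])) (fun e => h4 (by rw [e])) hjj
    (hF j hj).1 (hF j hj).2 (hF j' hj').1 (hF j' hj').2 hs hs'
  -- Three vertices in different parts would have pairwise distinct labels, all in `{a, b}` or all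
  -- in `{k, k'}`.
  have k1 := key hmm h5 h6 hs hs'
  have k2 := key (fun e => h8 (by rw [e])) h5 h7 hs hr
  have k3 := key (fun e => h9 (by rw [e])) h6 h7 hs' hr
  have e1 : some a ≠ some b := by simpa using hab
  have e2 : some k ≠ some k' := by simpa using hkk
  generalize label G T s = o at *
  generalize label G T s' = o' at *
  generalize label G T r = o'' at *
  grind

/-- An edge with two labels in both `T` and `S` forces `T` to have only four parts. -/
theorem eq_four_of_crossing {x y : V} (hx : Rest T S x) (hy : Rest T S y) (hxy : G.Adj x y)
    {a b : Fin n} (hab : a ≠ b) (hxa : label G T x = some a) (hyb : label G T y = some b)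
    {u v : Fin q} (huv : u ≠ v) (hxu : label G S x = some u) (hyv : label G S y = some v) :
    n = 4 := by
  by_contra hn
  have hn5 : 5 ≤ n := by have := h.four_le'; omega
  obtain ⟨s, hs, hxs⟩ := exists_adj_of_label hxu
  have hys : ¬ G.Adj y s := (h.hits_right hy.1 hy.2).not_adj hs
    (by rw [hyv]; simpa using Ne.symm huv)
  obtain ⟨m, m', hmm, hxm, hym, hxm', hym'⟩ :=
    exists_pair_avoid_two h.four_le (label G S x) (label G S y)
  obtain ⟨p, hp⟩ := h.right.nonempty m
  obtain ⟨p', hp'⟩ := h.right.nonempty m'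
  obtain ⟨k, l, hkl, hak, hbk, hsk, hal, hbl, hsl⟩ :=
    exists_pair_avoid_three hn5 (some a) (some b) (label G T s)
  -- A fifth index `r` excludes `{k, l}` as the labels of `p, p'`: it would also have to be `{k,
  -- r}`. So `p` misses `T k` and `T l`, as do `x`, `y` and `s`.
  obtain ⟨r, har, hbr, hkr, hlr⟩ := exists_avoid_four hn5 (some a) (some b) (some k) (some l)
  have key := fun {k l : Fin n} (hkl : some k ≠ some l) (hak : some a ≠ some k)
    (hbk : some b ≠ some k) (hal : some a ≠ some l) (hbl : some b ≠ some l) =>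
    h.labels_of_edge hx hy hxy hab hxa hyb (fun e => hkl (congrArg some e))
      (fun e => hak (congrArg some e)) (fun e => hbk (congrArg some e))
      (fun e => hal (congrArg some e)) (fun e => hbl (congrArg some e)) hmm hxm hym hxm' hym' hp hp'
  have e0 : some k ≠ some l := by simpa using hkl
  have k1 := key e0 hak hbk hal hbl
  have k2 := key hkr hak hbk har hbr
  have k3 := key hlr hal hbl har hbr
  have hpk : label G T p ≠ some k ∧ label G T p ≠ some l := by
    generalize label G T p = o at *
    generalize label G T p' = o' at *
    grind
  exact h.false_of_right_path hx hy hxy (fun e => hxm (by rw [hxu, e])) hs hxs.symm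
    (fun e => hys e.symm) hp hxm hym hkl (by rwa [hxa]) (by rwa [hyb]) hsk hpk.1 (by rwa [hxa])
    (by rwa [hyb]) hsl hpk.2

omit h in
theorem exists_common_or_ne {m : ℕ} (d : Fin m) (o o' : Option (Fin m)) :
    (∃ a, (o = none ∨ o = some a) ∧ (o' = none ∨ o' = some a)) ∨
      ∃ a b, a ≠ b ∧ o = some a ∧ o' = some b := by
  rcases o with _ | a <;> rcases o' with _ | b
  · exact Or.inl ⟨d, by simp⟩
  · exact Or.inl ⟨b, by simp⟩
  · exact Or.inl ⟨a, by simp⟩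
  · by_cases hab : a = b
    · exact Or.inl ⟨a, by simp [hab]⟩
    · exact Or.inr ⟨a, b, hab, rfl, rfl⟩

theorem parallel_or_crossing {x y : V} (hx : Rest T S x) (hy : Rest T S y) (hxy : G.Adj x y) :
    (∃ a j, Parallel G T S a j x y) ∨
      (n = 4 ∧ ∃ a b u v, a ≠ b ∧ u ≠ v ∧ label G T x = some a ∧ label G T y = some b ∧
        label G S x = some u ∧ label G S y = some v) := by
  have hn := h.four_le'
  have hq := h.four_le
  rcases exists_common_or_ne (⟨0, by omega⟩ : Fin n) (label G T x) (label G T y) with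
    ⟨a, hxa, hya⟩ | ⟨a, b, hab, hxa, hyb⟩ <;>
  rcases exists_common_or_ne (⟨0, by omega⟩ : Fin q) (label G S x) (label G S y) with
    ⟨j, hxj, hyj⟩ | ⟨u, v, huv, hxu, hyv⟩
  · exact Or.inl ⟨a, j, hx, hy, hxy, hxa, hya, hxj, hyj⟩
  · exact absurd (h.right_label_eq hx hy hxy hxa hya hxu hyv) huv
  · exact absurd (h.left_label_eq hx hy hxy hxj hyj hxa hyb) hab
  · exact Or.inr ⟨h.eq_four_of_crossing hx hy hxy hab hxa hyb huv hxu hyv, a, b, u, v, hab, huv,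
      hxa, hyb, hxu, hyv⟩

end Crossing

end TwoMultipartite

/-! ### Gluing colourings: n + 2 colours from a core, ⌈4n/3⌉ without remaining edges -/

open Classical in
/-- The index of the part of `T` that contains `x`, if there is one. -/
noncomputable def partIndex {V : Type*} {n : ℕ} (T : Fin n → Set V) (x : V) : Option (Fin n) :=
  if h : ∃ i, x ∈ T i then some h.choose else none

theorem IsMultipartite.partIndex_eq {V : Type*} {G : SimpleGraph V} {n : ℕ} {T : Fin n → Set V}
    (hT : IsMultipartite G T) {x : V} {i : Fin n} (hx : x ∈ T i) : partIndex T x = some i := by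
  have hex : ∃ i, x ∈ T i := ⟨i, hx⟩
  rw [partIndex, dif_pos hex, hT.eq_index hex.choose_spec hx]

namespace TwoMultipartite

variable {V : Type*} {G : SimpleGraph V} {n q : ℕ} {T : Fin n → Set V} {S : Fin q → Set V}

/-- Colourings of `T`, of `S` and of the rest that fit together. -/
theorem colorable_of_pieces (h : TwoMultipartite G T S) {m : ℕ} (cT cS cR : V → ℕ)
    (hT : ∀ i, ∀ t ∈ T i, cT t < m) (hS : ∀ j, ∀ s ∈ S j, cS s < m)
    (hR : ∀ x, Rest T S x → cR x < m)
    (hTT : ∀ i j, i ≠ j → ∀ t ∈ T i, ∀ t' ∈ T j, cT t ≠ cT t')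
    (hSS : ∀ i j, i ≠ j → ∀ s ∈ S i, ∀ s' ∈ S j, cS s ≠ cS s')
    (hRR : ∀ x y, Rest T S x → Rest T S y → G.Adj x y → cR x ≠ cR y)
    (hST : ∀ i j, ∀ t ∈ T i, ∀ s ∈ S j, G.Adj s t → cS s ≠ cT t)
    (hRT : ∀ x, Rest T S x → ∀ i, ∀ t ∈ T i, G.Adj x t → cR x ≠ cT t)
    (hRS : ∀ x, Rest T S x → ∀ j, ∀ s ∈ S j, G.Adj x s → cR x ≠ cS s) : G.Colorable m := by
  classical
  set f : V → ℕ := fun x => if ∃ i, x ∈ T i then cT x else if ∃ j, x ∈ S j then cS x else cR x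
    with hf
  have cases : ∀ x, (∃ i, x ∈ T i) ∧ f x = cT x ∨ (∃ j, x ∈ S j) ∧ f x = cS x ∨
      Rest T S x ∧ f x = cR x := by
    intro x
    by_cases h1 : ∃ i, x ∈ T i
    · exact Or.inl ⟨h1, by simp only [hf, if_pos h1]⟩
    · by_cases h2 : ∃ j, x ∈ S j
      · exact Or.inr (Or.inl ⟨h2, by simp only [hf, if_neg h1, if_pos h2]⟩)
      · exact Or.inr (Or.inr ⟨⟨not_exists.1 h1, not_exists.1 h2⟩,
          by simp only [hf, if_neg h1, if_neg h2]⟩)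
  refine colorable_of_properOn_univ (f := f) ⟨fun x _ => ?_, fun x _ y _ hxy => ?_⟩
  · rw [Finset.mem_range]
    rcases cases x with ⟨⟨i, hi⟩, e⟩ | ⟨⟨i, hi⟩, e⟩ | ⟨hr, e⟩ <;> rw [e]
    · exact hT i x hi
    · exact hS i x hi
    · exact hR x hr
  · rcases cases x with ⟨⟨i, hi⟩, e⟩ | ⟨⟨i, hi⟩, e⟩ | ⟨hr, e⟩ <;>
    rcases cases y with ⟨⟨j, hj⟩, e'⟩ | ⟨⟨j, hj⟩, e'⟩ | ⟨hr', e'⟩ <;> rw [e, e']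
    · exact hTT i j ((h.left.adj_iff hi hj).1 hxy) x hi y hj
    · exact (hST i j x hi y hj hxy.symm).symm
    · exact (hRT y hr' i x hi hxy.symm).symm
    · exact hST j i y hj x hi hxy
    · exact hSS i j ((h.right.adj_iff hi hj).1 hxy) x hi y hj
    · exact (hRS y hr' i x hi hxy.symm).symm
    · exact hRT x hr j y hj hxy
    · exact hRS x hr j y hj hxy
    · exact hRR x y hr hr' hxy

/-- A version of `colorable_of_pieces` in which every part has a single colour. -/
theorem colorable_of_parts (h : TwoMultipartite G T S) {m : ℕ} (cT : Fin n → ℕ) (cS : Fin q → ℕ)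
    (cR : V → ℕ) (hT : ∀ i, cT i < m) (hS : ∀ j, cS j < m) (hR : ∀ x, Rest T S x → cR x < m)
    (hTT : Function.Injective cT) (hSS : Function.Injective cS)
    (hRR : ∀ x y, Rest T S x → Rest T S y → G.Adj x y → cR x ≠ cR y)
    (hST : ∀ j, ∀ s ∈ S j, ∀ i, label G T s = some i → cS j ≠ cT i)
    (hRT : ∀ x, Rest T S x → ∀ i, label G T x = some i → cR x ≠ cT i)
    (hRS : ∀ x, Rest T S x → ∀ j, label G S x = some j → cR x ≠ cS j) : G.Colorable m := by
  have eT : ∀ {i t}, t ∈ T i → (partIndex T t).elim 0 cT = cT i := fun ht => by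
    rw [h.left.partIndex_eq ht]; rfl
  have eS : ∀ {i t}, t ∈ S i → (partIndex S t).elim 0 cS = cS i := fun ht => by
    rw [h.right.partIndex_eq ht]; rfl
  refine h.colorable_of_pieces (fun t => (partIndex T t).elim 0 cT)
    (fun s => (partIndex S s).elim 0 cS) cR ?_ ?_ hR ?_ ?_ hRR ?_ ?_ ?_
  · intro i t ht
    simpa only [eT ht] using hT i
  · intro i t ht
    simpa only [eS ht] using hS i
  · intro i j hij t ht t' ht'
    simpa only [eT ht, eT ht'] using hTT.ne hij
  · intro i j hij t ht t' ht'
    simpa only [eS ht, eS ht'] using hSS.ne hij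
  · intro i j t ht s hs hst
    simpa only [eT ht, eS hs] using hST j s hs i (h.label_right hs ht hst)
  · intro x hx i t ht hxt
    simpa only [eT ht] using hRT x hx i ((h.hits_left hx.1).label_eq ht hxt)
  · intro x hx i t ht hxt
    simpa only [eS ht] using hRS x hx i ((h.hits_right hx.1 hx.2).label_eq ht hxt)

section Colouring

variable [Finite V] (h : TwoMultipartite G T S)
include h

/-- If there is a core and the edges outside `T` and `S` respect the labels, then `n + 2` colours
suffice. -/
theorem Core.colorable {i : Fin n} {j : Fin q} (hc : Core G T S i j)
    (hk : CliqueBoundOn G Set.univ n)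
    (hR : ∀ z w, Rest T S z → Rest T S w → G.Adj z w →
      (label G T z).getD i = (label G T w).getD i ∧
        (label G S z).getD j = (label G S w).getD j) : G.Colorable (n + 2) := by
  classical
  -- An injection of the parts of S into those of T with `j ↦ i`. Parts other than `j` reuse a
  -- colour different from that of `T i`, the only part they may see; part `j` gets the new colour
  -- `n`.
  set c : Fin q → Fin n := fun k => Equiv.swap (Fin.castLE h.le j) i (Fin.castLE h.le k) with hcdef
  have hcinj : Function.Injective c := fun a b hab => by simpa [hcdef] using hab
  have hcj : c j = i := by simp [hcdef]
  set cS : Fin q → ℕ := fun k => if k = j then n else (c k : ℕ) with hcS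
  have hclass : ∀ (r : Fin n) (s : Fin q), ∃ f, ProperOn G
      {x | Rest T S x ∧ (label G T x).getD i = r ∧ (label G S x).getD j = s}
      (((Finset.range (n + 2)).erase (r : ℕ)).erase (cS s)) f := by
    intro r s
    -- No edges join different classes. A class misses an edge of T, hence is P₄-free, and `n` of
    -- the `n + 2` colours survive deleting those of `T r` and `S s`.
    obtain ⟨k, l, hkl, hrk, -, hrl, -⟩ := exists_pair_avoid_two h.four_le' (some r) none
    obtain ⟨u, hu⟩ := h.left.nonempty k
    obtain ⟨u', hu'⟩ := h.left.nonempty l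
    have hmiss : ∀ {x : V} {k : Fin n}, (label G T x).getD i = r → some r ≠ some k →
        label G T x ≠ some k := by
      rintro x k hx hk e
      rw [e] at hx
      exact hk (congrArg some hx.symm)
    refine PathFourFreeOn.exists_properOn (k := n)
      (h.noPath.pathFourFreeOn (h.left.adj hu hu' hkl) ?_) (hk.mono (Set.subset_univ _) le_rfl) ?_
    · rintro x ⟨hx, hxr, -⟩
      exact ⟨fun e => (h.hits_left hx.1).not_adj hu (hmiss hxr hrk) e.symm,
        fun e => (h.hits_left hx.1).not_adj hu' (hmiss hxr hrl) e.symm⟩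
    · have h1 := Finset.pred_card_le_card_erase (s := (Finset.range (n + 2)).erase (r : ℕ))
        (a := cS s)
      have h2 := Finset.pred_card_le_card_erase (s := Finset.range (n + 2)) (a := (r : ℕ))
      rw [Finset.card_range] at h2
      omega
  choose f hf using hclass
  have hmem : ∀ x, Rest T S x →
      f ((label G T x).getD i) ((label G S x).getD j) x < n + 2 ∧
      f ((label G T x).getD i) ((label G S x).getD j) x ≠ ((label G T x).getD i : ℕ) ∧
      f ((label G T x).getD i) ((label G S x).getD j) x ≠ cS ((label G S x).getD j) := by
    intro x hx
    have := (hf ((label G T x).getD i) ((label G S x).getD j)).1 x ⟨hx, rfl, rfl⟩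
    simp only [Finset.mem_erase, Finset.mem_range] at this
    exact ⟨this.2.2, this.2.1, this.1⟩
  refine h.colorable_of_parts (fun k => (k : ℕ)) cS
    (fun x => f ((label G T x).getD i) ((label G S x).getD j) x) ?_ ?_ ?_ ?_ ?_ ?_ ?_ ?_ ?_
  · intro k
    have := k.2
    omega
  · intro k
    have := (c k).2
    simp only [hcS]
    split_ifs <;> omega
  · exact fun x hx => (hmem x hx).1
  · exact Fin.val_injective
  · intro a b hab
    have h1 := (c a).2
    have h2 := (c b).2
    simp only [hcS] at hab
    split_ifs at hab with ha hb hb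
    · rw [ha, hb]
    · omega
    · omega
    · exact hcinj (Fin.val_injective hab)
  · intro x y hx hy hxy
    obtain ⟨e1, e2⟩ := hR x y hx hy hxy
    have := (hf ((label G T x).getD i) ((label G S x).getD j)).2 x ⟨hx, rfl, rfl⟩ y
      ⟨hy, e1.symm, e2.symm⟩ hxy
    rwa [← e1, ← e2]
  · intro k s hs a ha
    have := a.2
    simp only [hcS]
    split_ifs with hkj
    · omega
    · intro e
      have hca : c k = a := Fin.val_injective e
      have hai : a = i := by
        rcases hc k hkj s hs with e' | e' <;> rw [ha] at e'
        · cases e'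
        · exact Option.some.inj e'
      exact hkj (hcinj (by rw [hca, hcj, hai]))
  · intro x hx a ha
    have := (hmem x hx).2.1
    rw [ha] at this ⊢
    exact this
  · intro x hx a ha
    have := (hmem x hx).2.2
    rw [ha] at this ⊢
    exact this

omit [Finite V] in
/-- If there are no edges outside `T` and `S` and the vertices of `T` have neighbours in at most one
part of `S`, then `m` colours suffice for `3 m ≥ 4 n`. -/
theorem colorable_of_stable {m : ℕ} (hm : 4 * n ≤ 3 * m) (hmn : m ≤ 2 * n)
    (hTS : ∀ i, ∀ t ∈ T i, HitsAtMostOne G S t)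
    (hR : ∀ x y, Rest T S x → Rest T S y → ¬ G.Adj x y) : G.Colorable m := by
  classical
  have hn := h.four_le'
  have hqn := h.le
  -- `a` parts of T have one colour each, from `[0, a)`; the other `m - n` have a pair each, filling
  -- `[a, m)`. `b` is the size of `[a, m)`, which supplies single colours to S; the other parts of
  -- S, at most `3n - 2m`, have pairs inside `[0, a)`, which fit exactly because `4n ≤ 3m`.
  obtain ⟨a, ha⟩ : ∃ a, a = 2 * n - m := ⟨_, rfl⟩
  obtain ⟨b, hb⟩ : ∃ b, b = 2 * m - 2 * n := ⟨_, rfl⟩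
  -- A vertex takes the even member of its pair (offset `2(k - a)`) unless the one part it sees on
  -- the other side has that colour. The default `q` for a missing label is harmless: either colour
  -- works then.
  set tCol : ℕ → Option (Fin q) → ℕ := fun k o =>
    if k < a then k else if o.elim q Fin.val = 2 * (k - a) then a + 2 * (k - a) + 1
      else a + 2 * (k - a) with htCol
  set sCol : ℕ → Option (Fin n) → ℕ := fun k o =>
    if k < b then a + k else if o.elim n Fin.val = 2 * (k - b) then 2 * (k - b) + 1
      else 2 * (k - b) with hsCol
  have tCase : ∀ k o, (k < a ∧ tCol k o = k) ∨
      (a ≤ k ∧ o.elim q Fin.val = 2 * (k - a) ∧ tCol k o = a + 2 * (k - a) + 1) ∨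
      (a ≤ k ∧ o.elim q Fin.val ≠ 2 * (k - a) ∧ tCol k o = a + 2 * (k - a)) := by
    intro k o
    simp only [htCol]
    by_cases hk : k < a
    · exact Or.inl ⟨hk, by rw [if_pos hk]⟩
    · by_cases ho : o.elim q Fin.val = 2 * (k - a)
      · exact Or.inr (Or.inl ⟨not_lt.1 hk, ho, by rw [if_neg hk, if_pos ho]⟩)
      · exact Or.inr (Or.inr ⟨not_lt.1 hk, ho, by rw [if_neg hk, if_neg ho]⟩)
  have sCase : ∀ k o, (k < b ∧ sCol k o = a + k) ∨
      (b ≤ k ∧ o.elim n Fin.val = 2 * (k - b) ∧ sCol k o = 2 * (k - b) + 1) ∨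
      (b ≤ k ∧ o.elim n Fin.val ≠ 2 * (k - b) ∧ sCol k o = 2 * (k - b)) := by
    intro k o
    simp only [hsCol]
    by_cases hk : k < b
    · exact Or.inl ⟨hk, by rw [if_pos hk]⟩
    · by_cases ho : o.elim n Fin.val = 2 * (k - b)
      · exact Or.inr (Or.inl ⟨not_lt.1 hk, ho, by rw [if_neg hk, if_pos ho]⟩)
      · exact Or.inr (Or.inr ⟨not_lt.1 hk, ho, by rw [if_neg hk, if_neg ho]⟩)
  have tTwo : ∀ k, ∃ p p', ∀ o, tCol k o = p ∨ tCol k o = p' := by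
    intro k
    by_cases hk : k < a
    · exact ⟨k, k, fun o => by simp [htCol, hk]⟩
    · refine ⟨a + 2 * (k - a) + 1, a + 2 * (k - a), fun o => ?_⟩
      simp only [htCol, if_neg hk]
      split_ifs <;> simp
  have sTwo : ∀ k, ∃ p p', ∀ o, sCol k o = p ∨ sCol k o = p' := by
    intro k
    by_cases hk : k < b
    · exact ⟨a + k, a + k, fun o => by simp [hsCol, hk]⟩
    · refine ⟨2 * (k - b) + 1, 2 * (k - b), fun o => ?_⟩
      simp only [hsCol, if_neg hk]
      split_ifs <;> simp
  -- A remaining vertex sees one part of T and one of S at most, hence at most four colours, and `m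
  -- > 4`.
  have hfree : ∀ k l : ℕ, ∃ c < m, (∀ o, c ≠ tCol k o) ∧ ∀ o, c ≠ sCol l o := by
    intro k l
    obtain ⟨p1, p2, hp⟩ := tTwo k
    obtain ⟨p3, p4, hp'⟩ := sTwo l
    obtain ⟨c, hc, hc'⟩ : ∃ c ∈ Finset.range m, c ∉ ({p1, p2, p3, p4} : Finset ℕ) := by
      apply Finset.exists_mem_notMem_of_card_lt_card
      rw [Finset.card_range]
      exact Finset.card_le_four.trans_lt (by omega)
    simp only [Finset.mem_insert, Finset.mem_singleton, not_or] at hc'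
    refine ⟨c, Finset.mem_range.1 hc, fun o => ?_, fun o => ?_⟩
    · rcases hp o with e | e <;> rw [e] <;> tauto
    · rcases hp' o with e | e <;> rw [e] <;> tauto
  choose g hgm hgT hgS using hfree
  have eT : ∀ {i t}, t ∈ T i → (partIndex T t).elim 0 Fin.val = i.val := fun ht => by
    rw [h.left.partIndex_eq ht]; rfl
  have eS : ∀ {i t}, t ∈ S i → (partIndex S t).elim 0 Fin.val = i.val := fun ht => by
    rw [h.right.partIndex_eq ht]; rfl
  refine h.colorable_of_pieces (fun t => tCol ((partIndex T t).elim 0 Fin.val) (label G S t))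
    (fun s => sCol ((partIndex S s).elim 0 Fin.val) (label G T s))
    (fun x => g ((label G T x).elim 0 Fin.val) ((label G S x).elim 0 Fin.val)) ?_ ?_ ?_ ?_ ?_ ?_
    ?_ ?_ ?_
  · intro i t ht
    have := i.2
    simp only [eT ht, htCol]
    split_ifs <;> omega
  · intro i t ht
    have := i.2
    simp only [eS ht, hsCol]
    split_ifs <;> omega
  · exact fun x _ => hgm _ _
  · intro i j hij t ht t' ht'
    have := Fin.val_ne_of_ne hij
    simp only [eT ht, eT ht', htCol]
    split_ifs <;> omega
  · intro i j hij t ht t' ht'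
    have := Fin.val_ne_of_ne hij
    simp only [eS ht, eS ht', hsCol]
    split_ifs <;> omega
  · exact fun x y hx hy hxy => absurd hxy (hR x y hx hy)
  · intro i j t ht s hs hst
    have h1 := i.2
    have h2 := j.2
    simp only [eT ht, eS hs, h.label_right hs ht hst, (hTS i t ht).label_eq hs hst.symm]
    have h3 := tCase i (some j)
    have h4 := sCase j (some i)
    simp only [Option.elim_some] at h3 h4
    omega
  · intro x hx i t ht hxt
    simp only [eT ht, (h.hits_left hx.1).label_eq ht hxt, Option.elim_some]
    exact hgT _ _ _
  · intro x hx i t ht hxt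
    simp only [eS ht, (h.hits_right hx.1 hx.2).label_eq ht hxt, Option.elim_some]
    exact hgS _ _ _

end Colouring

end TwoMultipartite
-- Six colours for four parts, and the combination of all cases
namespace TwoMultipartite

variable {V : Type*} {G : SimpleGraph V} {n q : ℕ} {T : Fin n → Set V} {S : Fin q → Set V}

/-- Six colours suffice if all edges outside `T` and `S` join different labels in `T`. -/
theorem colorable_six (h : TwoMultipartite G T S) {a b k k' : Fin n} {u v j j' : Fin q}
    (hT : ∀ i, i = a ∨ i = b ∨ i = k ∨ i = k') (hS : ∀ i, i = u ∨ i = v ∨ i = j ∨ i = j')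
    (hab : a ≠ b) (hak : a ≠ k) (hak' : a ≠ k') (hbk : b ≠ k) (hbk' : b ≠ k') (hkk : k ≠ k')
    (huv : u ≠ v) (huj : u ≠ j) (huj' : u ≠ j') (hvj : v ≠ j) (hvj' : v ≠ j') (hjj : j ≠ j')
    (hj : ∀ s ∈ S j, label G T s ≠ some k) (hj' : ∀ s ∈ S j', label G T s ≠ some k')
    (hR : ∀ z w, Rest T S z → Rest T S w → G.Adj z w →
      label G T z ≠ none ∧ label G T w ≠ none ∧ label G T z ≠ label G T w) : G.Colorable 6 := by
  classical
  -- Only 2 (on `T k`, `S j`) and 3 (on `T k'`, `S j'`) are shared, as `hj` and `hj'` permit.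
  -- Remaining vertices labelled `a, b, k, k'` use the disjoint sets `{1}, {0}, {3, 4}, {2, 5}`, the
  -- S-label deciding within a pair; unlabelled ones have no edges among the rest and take 0.
  set cT : Fin n → ℕ := fun i => if i = a then 0 else if i = b then 1 else if i = k then 2 else 3
    with hcT
  set cS : Fin q → ℕ := fun i => if i = u then 4 else if i = v then 5 else if i = j then 2 else 3
    with hcS
  set cR : V → ℕ := fun x => (label G T x).elim 0 fun i => if i = a then 1 else if i = b then 0 else
    if i = k then (if label G S x = some u then 3 else 4) else
      if label G S x = some v then 2 else 5 with hcR
  have ta : cT a = 0 := by simp [hcT]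
  have tb : cT b = 1 := by simp [hcT, hab.symm]
  have tk : cT k = 2 := by simp [hcT, hak.symm, hbk.symm]
  have tk' : cT k' = 3 := by simp [hcT, hak'.symm, hbk'.symm, hkk.symm]
  have su : cS u = 4 := by simp [hcS]
  have sv : cS v = 5 := by simp [hcS, huv.symm]
  have sj : cS j = 2 := by simp [hcS, huj.symm, hvj.symm]
  have sj' : cS j' = 3 := by simp [hcS, huj'.symm, hvj'.symm, hjj.symm]
  have hr : ∀ x, (label G T x = none ∧ cR x = 0) ∨ (label G T x = some a ∧ cR x = 1) ∨
      (label G T x = some b ∧ cR x = 0) ∨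
      (label G T x = some k ∧ label G S x = some u ∧ cR x = 3) ∨
      (label G T x = some k ∧ label G S x ≠ some u ∧ cR x = 4) ∨
      (label G T x = some k' ∧ label G S x = some v ∧ cR x = 2) ∨
      (label G T x = some k' ∧ label G S x ≠ some v ∧ cR x = 5) := by
    intro x
    rcases hx : label G T x with _ | i
    · simp [hcR, hx]
    · rcases hT i with rfl | rfl | rfl | rfl
      · simp [hcR, hx]
      · simp [hcR, hx, hab.symm]
      · by_cases e : label G S x = some u <;> simp [hcR, hx, hak.symm, hbk.symm, e]
      · by_cases e : label G S x = some v <;>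
          simp [hcR, hx, hak'.symm, hbk'.symm, hkk.symm, e]
  refine h.colorable_of_parts cT cS cR ?_ ?_ ?_ ?_ ?_ ?_ ?_ ?_ ?_
  · intro i
    rcases hT i with rfl | rfl | rfl | rfl <;> omega
  · intro i
    rcases hS i with rfl | rfl | rfl | rfl <;> omega
  · intro x _
    rcases hr x with e | e | e | e | e | e | e <;> omega
  · intro i i' e
    rcases hT i with rfl | rfl | rfl | rfl <;> rcases hT i' with rfl | rfl | rfl | rfl <;>
      first | rfl | omega
  · intro i i' e
    rcases hS i with rfl | rfl | rfl | rfl <;> rcases hS i' with rfl | rfl | rfl | rfl <;>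
      first | rfl | omega
  · intro x y hx hy hxy
    obtain ⟨h1, h2, h3⟩ := hR x y hx hy hxy
    rcases hr x with e | e | e | e | e | e | e <;> rcases hr y with e' | e' | e' | e' | e' | e' | e' <;>
      first
      | omega
      | exact absurd e.1 h1
      | exact absurd e'.1 h2
      | exact absurd (e.1.trans e'.1.symm) h3
  · intro i s hs i' hi'
    rcases hS i with rfl | rfl | rfl | rfl <;> rcases hT i' with rfl | rfl | rfl | rfl <;>
      first
      | omega
      | exact absurd hi' (hj s hs)
      | exact absurd hi' (hj' s hs)
  · intro x _ i hi
    rcases hT i with rfl | rfl | rfl | rfl <;> rcases hr x with e | e | e | e | e | e | e <;>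
      first
      | omega
      | (have := e.1.symm.trans hi; simp_all)
  · intro x _ i hi
    rcases hS i with rfl | rfl | rfl | rfl <;> rcases hr x with e | e | e | e | e | e | e <;>
      first
      | omega
      | exact absurd hi e.2.1
      | (have := e.2.1.symm.trans hi; simp_all)

theorem fin_four_cases {m : ℕ} (hm : m = 4) {a b c d : Fin m} (hab : a ≠ b) (hac : a ≠ c)
    (had : a ≠ d) (hbc : b ≠ c) (hbd : b ≠ d) (hcd : c ≠ d) (i : Fin m) :
    i = a ∨ i = b ∨ i = c ∨ i = d := by
  simp only [Fin.ext_iff, ne_eq] at *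
  omega

/-- Vertices of `S j` and `S j'` have labels `{a, b}` or `{k, k'}` by `labels_of_edge`. So one of
the two matchings of `j, j'` with `k, k'` meets the requirements of `colorable_six`. -/
theorem colorable_of_crossing (h : TwoMultipartite G T S) (hn : n = 4) {x y : V}
    (hx : Rest T S x) (hy : Rest T S y) (hxy : G.Adj x y) {a b : Fin n} {u v : Fin q}
    (hab : a ≠ b) (huv : u ≠ v) (hxa : label G T x = some a) (hyb : label G T y = some b)
    (hxu : label G S x = some u) (hyv : label G S y = some v)
    (hR : ∀ z w, Rest T S z → Rest T S w → G.Adj z w →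
      label G T z ≠ none ∧ label G T w ≠ none ∧ label G T z ≠ label G T w) : G.Colorable 6 := by
  have hq : q = 4 := le_antisymm (h.le.trans hn.le) h.four_le
  obtain ⟨k, k', hkk, h1, h2, h3, h4⟩ := exists_pair_avoid_two h.four_le' (some a) (some b)
  obtain ⟨j, j', hjj, h5, h6, h7, h8⟩ := exists_pair_avoid_two h.four_le (some u) (some v)
  have hak : a ≠ k := fun e => h1 (congrArg some e)
  have hbk : b ≠ k := fun e => h2 (congrArg some e)
  have hak' : a ≠ k' := fun e => h3 (congrArg some e)
  have hbk' : b ≠ k' := fun e => h4 (congrArg some e)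
  have huj : u ≠ j := fun e => h5 (congrArg some e)
  have hvj : v ≠ j := fun e => h6 (congrArg some e)
  have huj' : u ≠ j' := fun e => h7 (congrArg some e)
  have hvj' : v ≠ j' := fun e => h8 (congrArg some e)
  have hT := fun i => fin_four_cases hn hab hak hak' hbk hbk' hkk i
  have hT' := fun i => fin_four_cases hn hab hak' hak hbk' hbk hkk.symm i
  have hS := fun i => fin_four_cases hq huv huj huj' hvj hvj' hjj i
  have key : ∀ s ∈ S j, ∀ s' ∈ S j', _ := fun s hs s' hs' =>
    h.labels_of_edge hx hy hxy hab hxa hyb hkk hak hbk hak' hbk' hjj (by rwa [hxu]) (by rwa [hyv])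
      (by rwa [hxu]) (by rwa [hyv]) hs hs'
  have e1 : some a ≠ some k := h1
  have e2 : some b ≠ some k := h2
  have e3 : some a ≠ some k' := h3
  have e4 : some b ≠ some k' := h4
  have e5 : some k ≠ some k' := by simpa using hkk
  by_cases hcase : (∀ s ∈ S j, label G T s ≠ some k) ∧ ∀ s ∈ S j', label G T s ≠ some k'
  · exact h.colorable_six hT hS hab hak hak' hbk hbk' hkk huv huj huj' hvj hvj' hjj hcase.1 hcase.2
      hR
  · refine h.colorable_six hT' hS hab hak' hak hbk' hbk hkk.symm huv huj huj' hvj hvj' hjj ?_ ?_ hR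
    · obtain ⟨p, hp⟩ := h.right.nonempty j
      obtain ⟨p', hp'⟩ := h.right.nonempty j'
      intro s hs hcon
      apply hcase
      refine ⟨fun r hr e => ?_, fun r hr e => ?_⟩
      · have c1 := key r hr p' hp'
        have c2 := key s hs p' hp'
        generalize label G T p' = o at *
        grind
      · have c2 := key s hs r hr
        grind
    · obtain ⟨p, hp⟩ := h.right.nonempty j
      obtain ⟨p', hp'⟩ := h.right.nonempty j'
      intro s hs hcon
      apply hcase
      refine ⟨fun r hr e => ?_, fun r hr e => ?_⟩
      · have c1 := key r hr s hs
        grind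
      · have c1 := key p hp r hr
        have c2 := key p hp s hs
        generalize label G T p = o at *
        grind

/-- The number of colours needed for `n ≥ 4`. -/
theorem colorable [Finite V] (h : TwoMultipartite G T S) (hk : CliqueBoundOn G Set.univ n) {m : ℕ}
    (hm : 4 * n ≤ 3 * m) (hmn : m ≤ 2 * n) : G.Colorable m := by
  have hn := h.four_le'
  have hnm : n + 2 ≤ m := by omega
  by_cases hedge : ∃ x y, Rest T S x ∧ Rest T S y ∧ G.Adj x y
  · by_cases hpar : ∃ x y a j, Parallel G T S a j x y
    · obtain ⟨x, y, a, j, hp⟩ := hpar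
      obtain ⟨i, hc, hR⟩ := hp.exists_core_forall h
      exact (hc.colorable h hk hR).mono hnm
    · have hcross := fun {x y : V} (hx : Rest T S x) (hy : Rest T S y) (hxy : G.Adj x y) =>
        (h.parallel_or_crossing hx hy hxy).resolve_left
          fun ⟨a, j, hp⟩ => hpar ⟨x, y, a, j, hp⟩
      obtain ⟨x, y, hx, hy, hxy⟩ := hedge
      obtain ⟨hn4, a, b, u, v, hab, huv, hxa, hyb, hxu, hyv⟩ := hcross hx hy hxy
      refine (h.colorable_of_crossing hn4 hx hy hxy hab huv hxa hyb hxu hyv ?_).mono (by omega)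
      intro z w hz hw hzw
      obtain ⟨-, c, d, -, -, hcd, -, hzc, hwd, -, -⟩ := hcross hz hw hzw
      rw [hzc, hwd]
      simpa using hcd
  · have hstable : ∀ x y, Rest T S x → Rest T S y → ¬ G.Adj x y :=
      fun x y hx hy hxy => hedge ⟨x, y, hx, hy, hxy⟩
    by_cases hTS : ∀ i, ∀ t ∈ T i, HitsAtMostOne G S t
    · exact h.colorable_of_stable hm hmn hTS hstable
    · simp only [HitsAtMostOne] at hTS
      push Not at hTS
      obtain ⟨i, t, ht, k, l, s, hs, s', hs', hts, hts', hkl⟩ := hTS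
      -- Since `t` sees two parts of S, its non-neighbours in S lie in one part `j`; so all other
      -- parts have label `i`, a core.
      obtain ⟨j, hj⟩ : ∃ j, ∀ c, ∀ p ∈ S c, c ≠ j → G.Adj t p := by
        by_cases hall : ∀ c, ∀ p ∈ S c, G.Adj t p
        · exact ⟨k, fun c p hp _ => hall c p hp⟩
        · push Not at hall
          obtain ⟨j, p, hp, htp⟩ := hall
          refine ⟨j, fun c p' hp' hc => ?_⟩
          by_contra htp'
          exact hc (h.right.nonadj_index_eq h.noK4 h.four_le hs hs' hp' hp hkl hts hts' htp' htp)
      have hc : Core G T S i j := fun c hc p hp => Or.inr (h.label_right hp ht (hj c p hp hc).symm)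
      exact (hc.colorable h hk fun z w hz hw hzw => absurd hzw (hstable z w hz hw)).mono hnm

end TwoMultipartite

/-! ### Choosing T and S; the upper bound for clique number at least 4 -/

/-- If the vertices outside a complete `n`-partite graph `T` contain no `K₄`, then `n + 2` colours
suffice. -/
theorem NoEdgeAndPath.colorable_of_cliqueBoundOn_three {V : Type*} [Finite V] {G : SimpleGraph V}
    (hP : NoEdgeAndPath G) {n : ℕ} (hn : 4 ≤ n) {T : Fin n → Set V} (hT : IsMultipartite G T)
    (hTl : ∀ {x}, (∀ i, x ∉ T i) → HitsAtMostOne G T x)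
    (hR : CliqueBoundOn G {x | ∀ i, x ∉ T i} 3) : G.Colorable (n + 2) := by
  classical
  have hpiece : ∀ (a b c : ℕ) (ha : a < n) (hb : b < n), a ≠ b → a ≠ c → b ≠ c →
      ∀ s : Set V, (∀ x ∈ s, ∀ i, x ∉ T i) →
      (∃ k l : Fin n, k ≠ l ∧ ∀ x ∈ s, label G T x ≠ some k ∧ label G T x ≠ some l) →
      ∃ f, ProperOn G s {a, b, c} f := by
    rintro a b c ha hb hab hac hbc s hs ⟨k, l, hkl, hl⟩
    obtain ⟨u, hu⟩ := hT.nonempty k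
    obtain ⟨u', hu'⟩ := hT.nonempty l
    refine (hP.pathFourFreeOn (hT.adj hu hu' hkl) fun x hx => ?_).exists_properOn
      (hR.mono hs le_rfl) (Finset.card_eq_three.2 ⟨a, b, c, hab, hac, hbc, rfl⟩).ge
    exact ⟨fun e => (hTl (hs x hx)).not_adj hu (hl x hx).1 e.symm,
      fun e => (hTl (hs x hx)).not_adj hu' (hl x hx).2 e.symm⟩
  set i0 : Fin n := ⟨0, by omega⟩ with hi0
  set i1 : Fin n := ⟨1, by omega⟩ with hi1
  set i2 : Fin n := ⟨2, by omega⟩ with hi2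
  set i3 : Fin n := ⟨3, by omega⟩ with hi3
  -- Part `i` of T has colour `i`. Outside vertices missing parts 0 and 1 may use those colours and
  -- `n`; the others miss parts 2 and 3 and use 2, 3 and `n + 1`.
  obtain ⟨f, hf1, hf2⟩ := hpiece 0 1 n (by omega) (by omega) (by omega) (by omega) (by omega)
    {x | (∀ i, x ∉ T i) ∧ label G T x ≠ some i0 ∧ label G T x ≠ some i1} (fun x hx => hx.1)
    ⟨i0, i1, by simp [hi0, hi1], fun x hx => hx.2⟩
  obtain ⟨g, hg1, hg2⟩ := hpiece 2 3 (n + 1) (by omega) (by omega) (by omega) (by omega) (by omega)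
    {x | (∀ i, x ∉ T i) ∧ (label G T x = some i0 ∨ label G T x = some i1)} (fun x hx => hx.1)
    ⟨i2, i3, by simp [hi2, hi3], fun x hx => by
      rcases hx.2 with e | e <;> rw [e] <;> simp [hi0, hi1, hi2, hi3]⟩
  simp only [Finset.mem_insert, Finset.mem_singleton] at hf1 hg1
  have eT : ∀ {i t}, t ∈ T i → (partIndex T t).elim 0 Fin.val = i.val := fun ht => by
    rw [hT.partIndex_eq ht]; rfl
  set c : V → ℕ := fun x => if ∃ i, x ∈ T i then (partIndex T x).elim 0 Fin.val else
    if label G T x = some i0 ∨ label G T x = some i1 then g x else f x with hc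
  have cases : ∀ x, (∃ i, x ∈ T i ∧ c x = i.val) ∨
      ((∀ i, x ∉ T i) ∧ (label G T x = some i0 ∨ label G T x = some i1) ∧ c x = g x) ∨
      ((∀ i, x ∉ T i) ∧ (label G T x ≠ some i0 ∧ label G T x ≠ some i1) ∧ c x = f x) := by
    intro x
    by_cases h1 : ∃ i, x ∈ T i
    · obtain ⟨i, hi⟩ := h1
      exact Or.inl ⟨i, hi, by simp only [hc, if_pos (⟨i, hi⟩ : ∃ i, x ∈ T i), eT hi]⟩
    · by_cases h2 : label G T x = some i0 ∨ label G T x = some i1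
      · exact Or.inr (Or.inl ⟨not_exists.1 h1, h2, by simp only [hc, if_neg h1, if_pos h2]⟩)
      · exact Or.inr (Or.inr ⟨not_exists.1 h1, not_or.1 h2,
          by simp only [hc, if_neg h1, if_neg h2]⟩)
  have cross : ∀ x y i, y ∈ T i → (∀ i, x ∉ T i) → G.Adj x y → c x ≠ i.val := by
    intro x y i hy hx hxy
    have hi := i.2
    have hlab := (hTl hx).label_eq hy hxy
    rcases cases x with ⟨k, hk, -⟩ | ⟨-, hl, e⟩ | ⟨-, hl, e⟩
    · exact absurd hk (hx k)
    · have h1 := hg1 x ⟨hx, hl⟩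
      rw [hlab] at hl
      have h2 : (i : ℕ) = 0 ∨ (i : ℕ) = 1 := by
        rcases hl with e' | e' <;> rw [Option.some.inj e'] <;> simp [hi0, hi1]
      omega
    · have h1 := hf1 x ⟨hx, hl⟩
      rw [hlab] at hl
      have h2 : (i : ℕ) ≠ 0 ∧ (i : ℕ) ≠ 1 :=
        ⟨fun e' => hl.1 (congrArg some (Fin.val_injective e')),
          fun e' => hl.2 (congrArg some (Fin.val_injective e'))⟩
      omega
  refine colorable_of_properOn_univ (f := c) ⟨fun x _ => ?_, fun x _ y _ hxy => ?_⟩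
  · rw [Finset.mem_range]
    rcases cases x with ⟨i, -, e⟩ | ⟨hx, hl, e⟩ | ⟨hx, hl, e⟩
    · have := i.2
      omega
    · have := hg1 x ⟨hx, hl⟩
      omega
    · have := hf1 x ⟨hx, hl⟩
      omega
  · rcases cases x with ⟨i, hi, e⟩ | ⟨hx, hl, e⟩ | ⟨hx, hl, e⟩ <;>
    rcases cases y with ⟨j, hj, e'⟩ | ⟨hy, hl', e'⟩ | ⟨hy, hl', e'⟩
    · rw [e, e']
      exact Fin.val_ne_of_ne ((hT.adj_iff hi hj).1 hxy)
    · rw [e]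
      exact (cross y x i hi hy hxy.symm).symm
    · rw [e]
      exact (cross y x i hi hy hxy.symm).symm
    · rw [e']
      exact cross x y j hj hx hxy
    · rw [e, e']
      exact hg2 x ⟨hx, hl⟩ y ⟨hy, hl'⟩ hxy
    · have := hg1 x ⟨hx, hl⟩
      have := hf1 y ⟨hy, hl'⟩
      omega
    · rw [e']
      exact cross x y j hj hx hxy
    · have := hf1 x ⟨hx, hl⟩
      have := hg1 y ⟨hy, hl'⟩
      omega
    · rw [e, e']
      exact hf2 x ⟨hx, hl⟩ y ⟨hy, hl'⟩ hxy

/-- A `(P₂ ∪ P₄, HVN)`-free graph with clique number `n ≥ 4` is `m`-colourable for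
`3 m ≥ 4 n`. -/
theorem NoEdgeAndPath.colorable_of_four_le {V : Type*} [Finite V] {G : SimpleGraph V}
    (hP : NoEdgeAndPath G) (hH : NoHalfJoinedK4 G) {n m : ℕ} (hn : 4 ≤ n)
    (hk : CliqueBoundOn G Set.univ n) {K : Finset V} (hK : G.IsClique K) (hKn : K.card = n)
    (hm : 4 * n ≤ 3 * m) (hmn : m ≤ 2 * n) : G.Colorable m := by
  classical
  obtain ⟨v, -, hv⟩ := exists_fin_of_isClique hK hKn
  set T := twinPart G Set.univ v with hTdef
  have hT : IsMultipartite G T := isMultipartite_twinPart hH hn (fun _ => Set.mem_univ _) hv hk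
  have hTl : ∀ {x}, (∀ i, x ∉ T i) → HitsAtMostOne G T x := fun {x} hx =>
    hitsAtMostOne_twinPart hH hn (fun _ => Set.mem_univ _) hv hk (Set.mem_univ x) hx
  set R : Set V := {x | ∀ i, x ∉ T i} with hR
  by_cases hR3 : CliqueBoundOn G R 3
  · exact (hP.colorable_of_cliqueBoundOn_three hn hT hTl hR3).mono (by omega)
  · obtain ⟨Q, hQR, hQ, hQmax⟩ : ∃ Q : Finset V, ↑Q ⊆ R ∧ G.IsClique Q ∧
        ∀ t : Finset V, ↑t ⊆ R → G.IsClique t → t.card ≤ Q.card := by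
      obtain ⟨Q, hQ, hmax⟩ := Set.exists_max_image {t : Finset V | ↑t ⊆ R ∧ G.IsClique t}
        Finset.card (Set.toFinite _) ⟨∅, by simp⟩
      exact ⟨Q, hQ.1, hQ.2, fun t h1 h2 => hmax t ⟨h1, h2⟩⟩
    have hq4 : 4 ≤ Q.card := by
      by_contra hlt
      exact hR3 fun t h1 h2 => (hQmax t h1 h2).trans (by omega)
    obtain ⟨w, hwQ, hw⟩ := exists_fin_of_isClique hQ rfl
    have hwR : ∀ i, w i ∈ R := fun i => hQR (hwQ i)
    have h : TwoMultipartite G T (twinPart G R w) :=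
      { noPath := hP
        noK4 := hH
        four_le := hq4
        le := hk Q (Set.subset_univ _) hQ
        left := hT
        right := isMultipartite_twinPart hH hq4 hwR hw hQmax
        disjoint := fun hx => hx.1 _
        hits_left := hTl
        hits_right := fun hx hx' => hitsAtMostOne_twinPart hH hq4 hwR hw hQmax hx hx' }
    exact h.colorable hk hm hmn
-- From the elementary forms back to freeness
section Converse

variable {V : Type*} {G : SimpleGraph V}

theorem NoEdgeAndPath.not_isIndContained (h : NoEdgeAndPath G) :
    ¬ graphP2P4.IsIndContained G := by
  rintro ⟨f⟩
  apply h (f (Sum.inl 0)) (f (Sum.inl 1)) (f (Sum.inr 0)) (f (Sum.inr 1)) (f (Sum.inr 2))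
    (f (Sum.inr 3)) <;> rw [f.map_adj_iff] <;>
    simp [graphP2P4, SimpleGraph.pathGraph_adj]

theorem NoHalfJoinedK4.not_isIndContained (h : NoHalfJoinedK4 G) :
    ¬ graphHVN.IsIndContained G := by
  rintro ⟨f⟩
  apply h (f 0) (f 3) (f 4) (f 1) (f 2) <;> rw [f.map_adj_iff] <;>
    simp [graphHVN, SimpleGraph.deleteEdges_adj]

end Converse

/-! ### The Grötzsch graph -/

section Grotzsch

instance : DecidableRel grotzschGraph.Adj := fun u v => by
  rcases u with _ | u | u <;> rcases v with _ | v | v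
  · exact inferInstanceAs (Decidable False)
  · exact inferInstanceAs (Decidable False)
  · exact inferInstanceAs (Decidable True)
  · exact inferInstanceAs (Decidable False)
  · exact inferInstanceAs (Decidable ((SimpleGraph.cycleGraph 5).Adj u v))
  · exact inferInstanceAs (Decidable ((SimpleGraph.cycleGraph 5).Adj u v))
  · exact inferInstanceAs (Decidable True)
  · exact inferInstanceAs (Decidable ((SimpleGraph.cycleGraph 5).Adj u v))
  · exact inferInstanceAs (Decidable False)

theorem grotzschGraph_triangle_free : ∀ a b : Option (Fin 5 ⊕ Fin 5), grotzschGraph.Adj a b →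
    ∀ c, grotzschGraph.Adj a c → ¬ grotzschGraph.Adj b c := by
  decide +kernel

set_option synthInstance.maxHeartbeats 200000 in
set_option synthInstance.maxSize 1000 in
theorem noEdgeAndPath_grotzschGraph : NoEdgeAndPath grotzschGraph := by
  -- Each hypothesis stands directly after the variables it mentions, so that the decision procedure
  -- prunes early.
  have key : ∀ e f : Option (Fin 5 ⊕ Fin 5), grotzschGraph.Adj e f →
      ∀ a, ¬ grotzschGraph.Adj e a → ¬ grotzschGraph.Adj f a →
      ∀ b, grotzschGraph.Adj a b → ¬ grotzschGraph.Adj e b → ¬ grotzschGraph.Adj f b →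
      ∀ c, grotzschGraph.Adj b c → ¬ grotzschGraph.Adj e c → ¬ grotzschGraph.Adj f c →
      ¬ grotzschGraph.Adj a c → ∀ d, grotzschGraph.Adj c d → ¬ grotzschGraph.Adj e d →
      ¬ grotzschGraph.Adj f d → ¬ grotzschGraph.Adj b d → grotzschGraph.Adj a d := by
    decide +kernel
  intro e f a b c d hef hab hbc hcd hac hbd had hea heb hec hed hfa hfb hfc hfd
  exact had (key e f hef a hea hfa b hab heb hfb c hbc hec hfc hac d hcd hed hfd hbd)

/-- The Mycielskian of a graph needs one more colour. -/
theorem colorable_of_colorable_mycielskian {V : Type*} {G : SimpleGraph V} {k : ℕ}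
    (h : (mycielskian G).Colorable (k + 1)) : G.Colorable k := by
  classical
  obtain ⟨C⟩ := h
  set c := C none with hc
  -- A vertex with the colour of the apex takes the colour of its copy, which differs from it; this
  -- frees the apex colour.
  set g : V → Fin (k + 1) := fun v =>
    if C (some (Sum.inl v)) = c then C (some (Sum.inr v)) else C (some (Sum.inl v)) with hg
  have hne : ∀ v, g v ≠ c := by
    intro v
    simp only [hg]
    split_ifs with h
    · exact C.valid (show (mycielskian G).Adj (some (Sum.inr v)) none from trivial)
    · exact h
  have hproper : ∀ u v, G.Adj u v → g u ≠ g v := by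
    intro u v huv
    have h1 := C.valid (show (mycielskian G).Adj (some (Sum.inl u)) (some (Sum.inl v)) from huv)
    have h2 := C.valid (show (mycielskian G).Adj (some (Sum.inl u)) (some (Sum.inr v)) from huv)
    have h3 := C.valid (show (mycielskian G).Adj (some (Sum.inr u)) (some (Sum.inl v)) from huv)
    simp only [hg]
    split_ifs with h4 h5 h5
    · exact absurd (h4.trans h5.symm) h1
    · exact h3
    · exact h2
    · exact h1
  have hcol : G.Coloring {i : Fin (k + 1) // i ≠ c} :=
    SimpleGraph.Coloring.mk (fun v => ⟨g v, hne v⟩)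
      fun {u v} huv e => hproper u v huv (congrArg Subtype.val e)
  have hcard : Fintype.card {i : Fin (k + 1) // i ≠ c} = k := by
    simp [Fintype.card_subtype_compl]
  simpa [hcard] using hcol.colorable

theorem not_colorable_three_grotzschGraph : ¬ grotzschGraph.Colorable 3 := by
  intro h
  have h2 := colorable_of_colorable_mycielskian h
  have h3 := SimpleGraph.chromaticNumber_cycleGraph_of_odd 5 (by omega) (by decide)
  have h4 := h2.chromaticNumber_le
  rw [h3] at h4
  exact absurd h4 (by decide)

theorem cliqueNum_eq_of_le {V : Type*} [Finite V] {G : SimpleGraph V} {n : ℕ}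
    (hle : ∀ s : Finset V, G.IsClique s → s.card ≤ n) {s : Finset V} (hs : G.IsClique s)
    (hn : n ≤ s.card) : G.cliqueNum = n := by
  refine le_antisymm ?_ (hn.trans (SimpleGraph.IsClique.card_le_cliqueNum (tc := hs)))
  obtain ⟨t, ht⟩ := G.exists_isNClique_cliqueNum
  rw [← ht.card_eq]
  exact hle t ht.isClique

theorem noHalfJoinedK4_grotzschGraph : NoHalfJoinedK4 grotzschGraph :=
  fun _ a b c _ hab hac _ hbc _ _ _ _ _ _ => grotzschGraph_triangle_free a b hab c hac hbc

theorem cliqueNum_grotzschGraph : grotzschGraph.cliqueNum = 2 := by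
  refine cliqueNum_eq_of_le (s := {none, some (Sum.inr 0)}) (fun s hs => ?_) ?_ (by decide)
  · by_contra! hcard
    obtain ⟨a, ha, b, hb, c, hc, hab, hac, hbc⟩ := Finset.two_lt_card.1 hcard
    exact grotzschGraph_triangle_free a b (hs ha hb hab) c (hs ha hc hac) (hs hb hc hbc)
  · have : grotzschGraph.Adj none (some (Sum.inr 0)) := trivial
    simp [this]

end Grotzsch

/-! ### The extremal graphs for clique number at least 4 -/

section Twin

variable {n : ℕ}

@[simp] theorem twinMultipartite_inl_inl (p q : Fin n × Fin n) :
    (twinMultipartite n).Adj (Sum.inl p) (Sum.inl q) ↔ p.1 ≠ q.1 := Iff.rfl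

@[simp] theorem twinMultipartite_inr_inr (p q : Fin n × Fin n) :
    (twinMultipartite n).Adj (Sum.inr p) (Sum.inr q) ↔ p.1 ≠ q.1 := Iff.rfl

@[simp] theorem twinMultipartite_inl_inr (p q : Fin n × Fin n) :
    (twinMultipartite n).Adj (Sum.inl p) (Sum.inr q) ↔ p.1 = q.2 ∧ p.2 = q.1 := Iff.rfl

@[simp] theorem twinMultipartite_inr_inl (p q : Fin n × Fin n) :
    (twinMultipartite n).Adj (Sum.inr p) (Sum.inl q) ↔ p.1 = q.2 ∧ p.2 = q.1 := Iff.rfl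

/-- An edge inside one side dominates that side, and the other side is complete multipartite, hence
P₄-free. A matching edge leaves only its two parts, which have no other edge between them. -/
theorem noEdgeAndPath_twinMultipartite : NoEdgeAndPath (twinMultipartite n) := by
  rintro (e | e) (f | f) (a | a) (b | b) (c | c) (d | d) <;>
    simp only [twinMultipartite_inl_inl, twinMultipartite_inr_inr, twinMultipartite_inl_inr,
      twinMultipartite_inr_inl] <;> grind

/-- A K₄ lies on one side, since matching edges are in no triangle. A vertex of that side misses at
most one of its vertices; one of the other side sees at most one. -/
theorem noHalfJoinedK4_twinMultipartite : NoHalfJoinedK4 (twinMultipartite n) := by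
  rintro (e | e) (a | a) (b | b) (c | c) (d | d) <;>
    simp only [twinMultipartite_inl_inl, twinMultipartite_inr_inr, twinMultipartite_inl_inr,
      twinMultipartite_inr_inl] <;> grind

theorem card_le_of_isClique_twinMultipartite (hn : 2 ≤ n)
    {s : Finset ((Fin n × Fin n) ⊕ (Fin n × Fin n))} (hs : (twinMultipartite n).IsClique s) :
    s.card ≤ n := by
  by_cases hcross : ∃ p q, Sum.inl p ∈ s ∧ Sum.inr q ∈ s
  · obtain ⟨p, q, hp, hq⟩ := hcross
    have hsub : s ⊆ {Sum.inl p, Sum.inr q} := by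
      intro x hx
      by_contra hne
      simp only [Finset.mem_insert, Finset.mem_singleton, not_or] at hne
      have h1 := hs hx hp hne.1
      have h2 := hs hx hq hne.2
      have h3 := hs hp hq (by simp)
      rcases x with x | x <;> simp at h1 h2 h3 <;> grind
    exact ((Finset.card_le_card hsub).trans Finset.card_le_two).trans hn
  · have hinj : Set.InjOn (Sum.elim Prod.fst Prod.fst :
        (Fin n × Fin n) ⊕ (Fin n × Fin n) → Fin n) s := by
      intro x hx y hy hxy
      by_contra hne
      have h1 := hs hx hy hne
      rcases x with x | x <;> rcases y with y | y
      · exact h1 hxy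
      · exact hcross ⟨x, y, hx, hy⟩
      · exact hcross ⟨y, x, hy, hx⟩
      · exact h1 hxy
    have := Finset.card_le_card_of_injOn _ (fun x _ => Finset.mem_univ _) hinj
    simpa using this

theorem cliqueNum_twinMultipartite (hn : 2 ≤ n) : (twinMultipartite n).cliqueNum = n := by
  classical
  have hinj : Function.Injective (fun i : Fin n =>
      (Sum.inl (i, ⟨0, by omega⟩) : (Fin n × Fin n) ⊕ (Fin n × Fin n))) := fun i j hij => by
    simpa using hij
  refine cliqueNum_eq_of_le (s := Finset.univ.image fun i : Fin n => Sum.inl (i, ⟨0, by omega⟩))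
    (fun s hs => card_le_of_isClique_twinMultipartite hn hs) ?_ ?_
  · intro x hx y hy hxy
    obtain ⟨i, -, rfl⟩ := Finset.mem_image.1 (Finset.mem_coe.1 hx)
    obtain ⟨j, -, rfl⟩ := Finset.mem_image.1 (Finset.mem_coe.1 hy)
    exact fun hij => hxy (by simp only at hij; rw [hij])
  · rw [Finset.card_image_of_injective _ hinj]
    simp

/-- Among `n` disjoint nonempty sets of colours at least `2 n - k` are singletons. -/
theorem two_mul_le_card_add_card_filter {k : ℕ} (C : Fin n → Finset (Fin k))
    (hne : ∀ i, (C i).Nonempty) (hdisj : ∀ i j, i ≠ j → Disjoint (C i) (C j)) :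
    2 * n ≤ k + (Finset.univ.filter fun i => (C i).card = 1).card := by
  have h1 : ∑ i, (C i).card ≤ k := by
    rw [← Finset.card_biUnion fun i _ j _ hij => hdisj i j hij]
    simpa using Finset.card_le_univ (Finset.univ.biUnion C)
  have h2 : ∑ _i : Fin n, 2 ≤ ∑ i, ((C i).card + if (C i).card = 1 then 1 else 0) := by
    refine Finset.sum_le_sum fun i _ => ?_
    have := (hne i).card_pos
    split_ifs <;> omega
  rw [Finset.sum_add_distrib, ← Finset.card_filter] at h2
  simp only [Finset.sum_const, Finset.card_univ, Fintype.card_fin, smul_eq_mul] at h2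
  omega

/-- Parts of one side use disjoint colour sets, so at least `2n - k` are one-coloured. One-coloured
parts `A i` and `B j` are joined by an edge and differ in colour, so `2(2n - k) ≤ k`. -/
theorem four_mul_le_of_colorable_twinMultipartite (hn : 0 < n) {k : ℕ}
    (h : (twinMultipartite n).Colorable k) : 4 * n ≤ 3 * k := by
  classical
  obtain ⟨c⟩ := h
  set A : Fin n → Finset (Fin k) := fun i => Finset.univ.image fun s => c (Sum.inl (i, s)) with hA
  set B : Fin n → Finset (Fin k) := fun i => Finset.univ.image fun s => c (Sum.inr (i, s)) with hB
  have hAmem : ∀ i s, c (Sum.inl (i, s)) ∈ A i := fun i s =>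
    Finset.mem_image_of_mem _ (Finset.mem_univ s)
  have hBmem : ∀ i s, c (Sum.inr (i, s)) ∈ B i := fun i s =>
    Finset.mem_image_of_mem _ (Finset.mem_univ s)
  have hAd : ∀ i j, i ≠ j → Disjoint (A i) (A j) := by
    intro i j hij
    rw [Finset.disjoint_left]
    intro x hx hy
    obtain ⟨s, -, rfl⟩ := Finset.mem_image.1 hx
    obtain ⟨t, -, ht⟩ := Finset.mem_image.1 hy
    exact c.valid (show (twinMultipartite n).Adj (Sum.inl (j, t)) (Sum.inl (i, s)) from hij.symm) ht
  have hBd : ∀ i j, i ≠ j → Disjoint (B i) (B j) := by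
    intro i j hij
    rw [Finset.disjoint_left]
    intro x hx hy
    obtain ⟨s, -, rfl⟩ := Finset.mem_image.1 hx
    obtain ⟨t, -, ht⟩ := Finset.mem_image.1 hy
    exact c.valid (show (twinMultipartite n).Adj (Sum.inr (j, t)) (Sum.inr (i, s)) from hij.symm) ht
  have hA2 := two_mul_le_card_add_card_filter A (fun i => ⟨_, hAmem i ⟨0, hn⟩⟩) hAd
  have hB2 := two_mul_le_card_add_card_filter B (fun i => ⟨_, hBmem i ⟨0, hn⟩⟩) hBd
  set MA := Finset.univ.filter fun i => (A i).card = 1 with hMA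
  set MB := Finset.univ.filter fun i => (B i).card = 1 with hMB
  have hUA : (MA.biUnion A).card = MA.card := by
    rw [Finset.card_biUnion fun i _ j _ hij => hAd i j hij, Finset.card_eq_sum_ones]
    exact Finset.sum_congr rfl fun i hi => (Finset.mem_filter.1 hi).2
  have hUB : (MB.biUnion B).card = MB.card := by
    rw [Finset.card_biUnion fun i _ j _ hij => hBd i j hij, Finset.card_eq_sum_ones]
    exact Finset.sum_congr rfl fun i hi => (Finset.mem_filter.1 hi).2
  have hdisj : Disjoint (MA.biUnion A) (MB.biUnion B) := by
    rw [Finset.disjoint_left]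
    intro x hx hy
    obtain ⟨i, hi, hxi⟩ := Finset.mem_biUnion.1 hx
    obtain ⟨j, hj, hxj⟩ := Finset.mem_biUnion.1 hy
    have h1 := Finset.card_le_one.1 (Finset.mem_filter.1 hi).2.le _ hxi _ (hAmem i j)
    have h2 := Finset.card_le_one.1 (Finset.mem_filter.1 hj).2.le _ hxj _ (hBmem j i)
    exact c.valid (show (twinMultipartite n).Adj (Sum.inl (i, j)) (Sum.inr (j, i)) from ⟨rfl, rfl⟩)
      (h1.symm.trans h2)
  have := Finset.card_le_univ (MA.biUnion A ∪ MB.biUnion B)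
  rw [Finset.card_union_of_disjoint hdisj, hUA, hUB, Fintype.card_fin] at this
  omega

end Twin

/-! ### Ceilings and the final assembly -/

section Bounds

theorem four_mul_le_three_mul_ceil (n : ℕ) : 4 * n ≤ 3 * ⌈(4 / 3 : ℚ) * (n : ℚ)⌉₊ := by
  have h := Nat.le_ceil ((4 / 3 : ℚ) * (n : ℚ))
  have : (4 * n : ℚ) ≤ 3 * (⌈(4 / 3 : ℚ) * (n : ℚ)⌉₊ : ℚ) := by linarith
  exact_mod_cast this

theorem ceil_le_of_four_mul_le {n k : ℕ} (h : 4 * n ≤ 3 * k) :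
    ⌈(4 / 3 : ℚ) * (n : ℚ)⌉₊ ≤ k := by
  rw [Nat.ceil_le]
  have : (4 * n : ℚ) ≤ 3 * k := by exact_mod_cast h
  linarith

theorem IsP2P4HVNFree.chromaticNumber_le {V : Type*} [Finite V] {G : SimpleGraph V}
    (h : IsP2P4HVNFree G) :
    (G.cliqueNum = 2 → G.chromaticNumber ≤ 4) ∧
    (G.cliqueNum = 3 → G.chromaticNumber ≤ 10) ∧
    (4 ≤ G.cliqueNum → G.chromaticNumber ≤ (⌈(4 / 3 : ℚ) * (G.cliqueNum : ℚ)⌉₊ : ℕ)) := by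
  have hP := noEdgeAndPath_of_not_isIndContained h.1
  have hH := noHalfJoinedK4_of_not_isIndContained h.2
  have hk : CliqueBoundOn G Set.univ G.cliqueNum := fun t _ ht =>
    SimpleGraph.IsClique.card_le_cliqueNum (tc := ht)
  obtain ⟨K, hK⟩ := G.exists_isNClique_cliqueNum
  obtain ⟨v, -, hv⟩ := exists_fin_of_isClique hK.isClique hK.card_eq
  refine ⟨fun h2 => ?_, fun h3 => ?_, fun h4 => ?_⟩
  · rw [h2] at hk
    exact (hP.colorable_four hk (hv ⟨0, by omega⟩ ⟨1, by omega⟩ (by simp))).chromaticNumber_le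
  · rw [h3] at hk
    exact (hP.colorable_ten hk (hv ⟨0, by omega⟩ ⟨1, by omega⟩ (by simp))
      (hv ⟨0, by omega⟩ ⟨2, by omega⟩ (by simp))
      (hv ⟨1, by omega⟩ ⟨2, by omega⟩ (by simp))).chromaticNumber_le
  · exact (hP.colorable_of_four_le hH h4 hk hK.isClique hK.card_eq
      (four_mul_le_three_mul_ceil _) (ceil_le_of_four_mul_le (by omega))).chromaticNumber_le

end Bounds

theorem theorem1p1 :
    -- the three upper bounds
    (∀ (V : Type*) [Finite V] (G : SimpleGraph V), IsP2P4HVNFree G →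
      (G.cliqueNum = 2 → G.chromaticNumber ≤ 4) ∧
      (G.cliqueNum = 3 → G.chromaticNumber ≤ 10) ∧
      (4 ≤ G.cliqueNum → G.chromaticNumber ≤ (⌈(4 / 3 : ℚ) * (G.cliqueNum : ℚ)⌉₊ : ℕ))) ∧
    -- tightness for clique number 2
    (IsP2P4HVNFree grotzschGraph ∧ grotzschGraph.cliqueNum = 2 ∧
      grotzschGraph.chromaticNumber = 4) ∧
    -- tightness for every clique number at least 4
    (∀ n : ℕ, 4 ≤ n →
      Nat.card ((Fin n × Fin n) ⊕ (Fin n × Fin n)) = 2 * n ^ 2 ∧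
      IsP2P4HVNFree (twinMultipartite n) ∧ (twinMultipartite n).cliqueNum = n ∧
      (twinMultipartite n).chromaticNumber = (⌈(4 / 3 : ℚ) * (n : ℚ)⌉₊ : ℕ)) := by
  refine ⟨fun V _ G hG => hG.chromaticNumber_le, ?_, fun n hn => ?_⟩
  · have hfree : IsP2P4HVNFree grotzschGraph :=
      ⟨noEdgeAndPath_grotzschGraph.not_isIndContained,
        noHalfJoinedK4_grotzschGraph.not_isIndContained⟩
    refine ⟨hfree, cliqueNum_grotzschGraph, le_antisymm
      (hfree.chromaticNumber_le.1 cliqueNum_grotzschGraph) ?_⟩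
    refine SimpleGraph.le_chromaticNumber_iff_colorable.2 fun m hm => ?_
    by_contra hlt
    refine not_colorable_three_grotzschGraph (hm.mono ?_)
    have h4 : ¬ 4 ≤ m := fun h => hlt (by exact_mod_cast h)
    omega
  · have hfree : IsP2P4HVNFree (twinMultipartite n) :=
      ⟨noEdgeAndPath_twinMultipartite.not_isIndContained,
        noHalfJoinedK4_twinMultipartite.not_isIndContained⟩
    have hω := cliqueNum_twinMultipartite (n := n) (by omega)
    refine ⟨?_, hfree, hω, le_antisymm ?_ ?_⟩
    · simp only [Nat.card_eq_fintype_card, Fintype.card_sum, Fintype.card_prod, Fintype.card_fin]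
      ring
    · have := hfree.chromaticNumber_le.2.2
      rw [hω] at this
      exact this hn
    · refine SimpleGraph.le_chromaticNumber_iff_colorable.2 fun m hm => ?_
      exact_mod_cast ceil_le_of_four_mul_le
        (four_mul_le_of_colorable_twinMultipartite (by omega) hm)
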